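/- For $n\in\mathbb{N}=\{0,1,2,\dots\}$ let $J_n$ and $Y_n$ denote the Bessel functions of the first and second kind of order $n$, and for $n\ge 1$ and real $z>0$ put $$C_n(z):=-Y_n(z)\left(\frac z2\right)^n\frac{\pi}{\Gamma(n)}.$$ Let $m,p\in\mathbb{N}$ and $x,y\in\mathbb{R}$ with $x>2y\ge 0$ and $p\ge\max\{m-2,x\}$, and let $r=y/x$. Then the series below converges, and $$\sum_{n=p+1}^{\infty}|J_n(y)|\,|Y_{n+m}(x)|\le\frac{2(2p+m+2)^{m-1}\,C_{p+m+1}(x)\,r^{p+1}}{\pi x^m(1-2r)}.$$ -/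

import Mathlib

open scoped Nat

/-- Bessel function of the first kind `J_n(z)` of order `n ∈ ℕ` at a real argument. -/
noncomputable def besselJ (n : ℕ) (z : ℝ) : ℝ :=
  ∑' k : ℕ, (-1 : ℝ) ^ k / ((k ! : ℝ) * ((n + k)! : ℝ)) * (z / 2) ^ (2 * k + n)

/-- Bessel function of the second kind `Y_n(z)` of order `n ∈ ℕ` at a real argument `z > 0`,
by Neumann's expansion
`Y_n(z) = -(1/π) (z/2)^(-n) ∑_{k<n} ((n-k-1)!/k!) (z/2)^(2k) + (2/π) log(z/2) J_n(z)
  - (1/π) (z/2)^n ∑_{k≥0} (ψ(k+1) + ψ(n+k+1)) (-1)^k (z/2)^(2k) / (k! (n+k)!)`,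
where the digamma values are written out as `ψ(j+1) = H_j - γ`, with `H_j` the `j`-th harmonic
number and `γ` Euler's constant. -/
noncomputable def besselY (n : ℕ) (z : ℝ) : ℝ :=
  -(1 / Real.pi) * ((z / 2) ^ n)⁻¹ *
      ∑ k ∈ Finset.range n, ((n - k - 1)! : ℝ) / (k ! : ℝ) * (z / 2) ^ (2 * k)
    + 2 / Real.pi * Real.log (z / 2) * besselJ n z
    - 1 / Real.pi * (z / 2) ^ n *
      ∑' k : ℕ, (((harmonic k : ℚ) : ℝ) + ((harmonic (n + k) : ℚ) : ℝ)
          - 2 * Real.eulerMascheroniConstant) *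
        ((-1 : ℝ) ^ k / ((k ! : ℝ) * ((n + k)! : ℝ)) * (z / 2) ^ (2 * k))

/-- `C_n(z) = -Y_n(z) (z/2)^n π / Γ(n)`, for `n ≥ 1` and `z > 0`. -/
noncomputable def besselC (n : ℕ) (z : ℝ) : ℝ :=
  -besselY n z * (z / 2) ^ n * (Real.pi / Real.Gamma (n : ℝ))

/-! The sum is dominated termwise by a geometric series of ratio `2 * (y / x)`. For `J` the bound is
`(y / 2) ^ n / n!` (`abs_besselJ_le`), from an energy that decreases along the positive axis. For
`Y` the point is that `C_n(x)` does not increase in `n` beyond the turning point: the three-term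
recurrence turns `C_{n+1} - C_{n+2}` into a positive multiple of `-Y_n(x)`, so everything rests on
`Y_n(x) ≤ 0` for `0 < x ≤ n` (`besselY_nonpos`).

This sign is hard to see in Neumann's expansion but visible in Schläfli's formula, which writes `π
Y_n(x)` as `∫₀^π sin(x sin θ - n θ) dθ` minus the integral over `t > 0` of `(e^{nt} + (-1)^n
e^{-nt}) e^{-x sinh t}`. The second integrand is nonnegative, and the first integral is nonpositive
by a monotone-phase argument. The formula (`pi_mul_besselY_eq_schlafli`) holds because both sides
obey the same recurrence in `n`, while for orders 0 and 1 their differences solve Bessel's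
first-order system with limit zero at the origin, hence vanish.

The product of the two bounds contains `(p+k+m)! / (p+1+k)!`. Each step in `k` at most doubles it,
since `m ≤ p + 2`; at `k = 0` the inequality of the means gives the power of `2p + m + 2`. -/

open MeasureTheory Set Filter Topology

/-! ### Power series with coefficients of size `O(1 / k!)` -/

/-- The sum of the power series with coefficients `a`. -/
noncomputable def powerSum (a : ℕ → ℝ) (t : ℝ) : ℝ := ∑' k : ℕ, a k * t ^ k

/-- Coefficients dominated by those of a multiple of the exponential series. -/
def ExpBounded (a : ℕ → ℝ) : Prop := ∃ C : ℝ, ∀ k, |a k| ≤ C / (k ! : ℝ)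

namespace ExpBounded

variable {a b : ℕ → ℝ}

theorem summable (ha : ExpBounded a) (t : ℝ) : Summable fun k => a k * t ^ k := by
  obtain ⟨C, hC⟩ := ha
  refine Summable.of_norm_bounded (g := fun k => C * (|t| ^ k / (k ! : ℝ)))
    ((Real.summable_pow_div_factorial |t|).mul_left C) fun k => ?_
  rw [Real.norm_eq_abs, abs_mul, abs_pow]
  calc |a k| * |t| ^ k ≤ C / (k ! : ℝ) * |t| ^ k := by gcongr; exact hC k
    _ = _ := by ring

theorem add (ha : ExpBounded a) (hb : ExpBounded b) : ExpBounded fun k => a k + b k := by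
  obtain ⟨C, hC⟩ := ha
  obtain ⟨D, hD⟩ := hb
  refine ⟨C + D, fun k => (abs_add_le _ _).trans ?_⟩
  rw [add_div]
  exact add_le_add (hC k) (hD k)

theorem deriv (ha : ExpBounded a) : ExpBounded fun k => ((k : ℝ) + 1) * a (k + 1) := by
  obtain ⟨C, hC⟩ := ha
  refine ⟨C, fun k => ?_⟩
  have h := hC (k + 1)
  have hk : (0 : ℝ) < (k : ℝ) + 1 := by positivity
  rw [abs_mul, abs_of_pos hk]
  rw [Nat.factorial_succ] at h
  push_cast at h
  calc ((k : ℝ) + 1) * |a (k + 1)| ≤ ((k : ℝ) + 1) * (C / (((k : ℝ) + 1) * (k ! : ℝ))) := by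
        gcongr
    _ = C / (k ! : ℝ) := by field_simp

theorem shift (ha : ExpBounded a) : ExpBounded fun k => a (k + 1) := by
  obtain ⟨C, hC⟩ := ha
  refine ⟨C, fun k => (hC (k + 1)).trans ?_⟩
  have hC0 : 0 ≤ C := by simpa using (abs_nonneg _).trans (hC 0)
  gcongr
  omega

theorem powerSum_eq (ha : ExpBounded a) (t : ℝ) :
    powerSum a t = a 0 + t * powerSum (fun k => a (k + 1)) t := by
  rw [powerSum, (ha.summable t).tsum_eq_zero_add, powerSum, ← tsum_mul_left]
  simp only [pow_zero, mul_one]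
  congr 1
  exact tsum_congr fun k => by ring

theorem powerSum_add (ha : ExpBounded a) (hb : ExpBounded b) (t : ℝ) :
    powerSum (fun k => a k + b k) t = powerSum a t + powerSum b t := by
  rw [powerSum, powerSum, powerSum, ← (ha.summable t).tsum_add (hb.summable t)]
  exact tsum_congr fun k => by ring

theorem hasDerivAt (ha : ExpBounded a) (t : ℝ) :
    HasDerivAt (powerSum a) (powerSum (fun k => ((k : ℝ) + 1) * a (k + 1)) t) t := by
  set R := |t| + 1 with hR
  obtain ⟨C, hC⟩ := ha.deriv
  -- With the constant term split off, termwise differentiation involves no truncated exponent `k -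
  -- 1`. On the ball of radius `R = |t| + 1` the derivatives are dominated by an exponential series.
  have key : HasDerivAt (fun s => ∑' k : ℕ, a (k + 1) * s ^ (k + 1))
      (∑' k : ℕ, (((k : ℝ) + 1) * a (k + 1)) * t ^ k) t := by
    refine hasDerivAt_tsum_of_isPreconnected (u := fun k => C * (R ^ k / (k ! : ℝ)))
      (t := Metric.ball (0 : ℝ) R)
      (g := fun k s => a (k + 1) * s ^ (k + 1))
      (g' := fun k s => (((k : ℝ) + 1) * a (k + 1)) * s ^ k) ((Real.summable_pow_div_factorial R).mul_left C)
      Metric.isOpen_ball (convex_ball _ _).isPreconnected (y₀ := 0) ?_ ?_ ?_ ?_ ?_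
    · intro k s _
      have h := (hasDerivAt_pow (k + 1) s).const_mul (a (k + 1))
      refine h.congr_deriv ?_
      push_cast
      ring
    · intro k s hs
      rw [Real.norm_eq_abs, abs_mul, abs_pow]
      have hs' : |s| ≤ R := by
        have := Metric.mem_ball.1 hs
        rw [dist_zero_right, Real.norm_eq_abs] at this
        exact this.le
      calc |((k : ℝ) + 1) * a (k + 1)| * |s| ^ k ≤ C / (k ! : ℝ) * R ^ k := by
            gcongr
            exact (abs_nonneg _).trans (hC k)
            exact hC k
        _ = _ := by ring
    · simp [hR]; positivity
    · simp
    · simp [hR]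
  have h2 : powerSum a = fun s => a 0 + ∑' k : ℕ, a (k + 1) * s ^ (k + 1) := by
    funext s
    rw [powerSum, (ha.summable s).tsum_eq_zero_add]
    simp
  rw [h2]
  exact key.const_add _

theorem continuous (ha : ExpBounded a) : Continuous (powerSum a) :=
  continuous_iff_continuousAt.2 fun t => (ha.hasDerivAt t).continuousAt

end ExpBounded

theorem powerSum_const_mul (a : ℕ → ℝ) (c t : ℝ) :
    powerSum (fun k => c * a k) t = c * powerSum a t := by
  rw [powerSum, powerSum, ← tsum_mul_left]
  exact tsum_congr fun k => by ring

theorem powerSum_zero (a : ℕ → ℝ) : powerSum a 0 = a 0 := by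
  rw [powerSum, tsum_eq_single 0]
  · simp
  · intro k hk
    simp [hk]

/-- Comparison of coefficients in a three-term relation between power series. -/
theorem powerSum_three_term {a b d : ℕ → ℝ} {c e : ℝ} (ha : ExpBounded a) (hd : ExpBounded d)
    (h0 : a 0 = c * d 0 + e) (h : ∀ k, b k + a (k + 1) = c * d (k + 1)) (t : ℝ) :
    t * powerSum b t + powerSum a t = c * powerSum d t + e := by
  have hb : b = fun k => c * d (k + 1) + (-1) * a (k + 1) := by
    funext k
    linarith [h k]
  have h1 : powerSum b t
      = c * powerSum (fun k => d (k + 1)) t - powerSum (fun k => a (k + 1)) t := by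
    have hs1 := (hd.shift.summable t).mul_left c
    have hs2 := ha.shift.summable t
    rw [hb]
    simp only [powerSum]
    rw [← tsum_mul_left, ← hs1.tsum_sub hs2]
    exact tsum_congr fun k => by ring
  rw [ha.powerSum_eq, hd.powerSum_eq, h1, h0]
  ring

/-! ### The series of `J_n` and the bound for it -/

/-- Coefficients of `(z / 2) ^ (-n) J_n(z)` in powers of `(z / 2) ^ 2`. -/
noncomputable def coeffJ (n k : ℕ) : ℝ := (-1 : ℝ) ^ k / ((k ! : ℝ) * ((n + k)! : ℝ))

/-- The sum of digamma values `ψ(k + 1) + ψ(n + k + 1)`. -/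
noncomputable def digammaSum (n k : ℕ) : ℝ :=
  ((harmonic k : ℚ) : ℝ) + ((harmonic (n + k) : ℚ) : ℝ) - 2 * Real.eulerMascheroniConstant

/-- Coefficients of the regular non-logarithmic part of `Y_n`. -/
noncomputable def coeffY (n k : ℕ) : ℝ := digammaSum n k * coeffJ n k

theorem abs_coeffJ (n k : ℕ) : |coeffJ n k| = 1 / ((k ! : ℝ) * ((n + k)! : ℝ)) := by
  rw [coeffJ, abs_div, abs_pow, abs_neg, abs_one, one_pow, abs_of_nonneg (by positivity)]

theorem expBounded_coeffJ (n : ℕ) : ExpBounded (coeffJ n) := by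
  refine ⟨1, fun k => ?_⟩
  rw [abs_coeffJ]
  have h : (1 : ℝ) ≤ ((n + k)! : ℝ) := by exact_mod_cast Nat.factorial_pos _
  have h2 : (1 : ℝ) ≤ (k ! : ℝ) := by exact_mod_cast Nat.factorial_pos _
  gcongr
  nlinarith

theorem cast_harmonic_succ (n : ℕ) :
    ((harmonic (n + 1) : ℚ) : ℝ) = ((harmonic n : ℚ) : ℝ) + 1 / ((n : ℝ) + 1) := by
  rw [harmonic_succ]
  push_cast
  rw [one_div]

theorem cast_harmonic_nonneg (n : ℕ) : (0 : ℝ) ≤ ((harmonic n : ℚ) : ℝ) := by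
  induction n with
  | zero => simp
  | succ n ih => rw [cast_harmonic_succ]; positivity

theorem cast_harmonic_le (n : ℕ) : ((harmonic n : ℚ) : ℝ) ≤ n := by
  induction n with
  | zero => simp
  | succ n ih =>
    rw [cast_harmonic_succ]
    push_cast
    have : 1 / ((n : ℝ) + 1) ≤ 1 := by
      rw [div_le_one (by positivity)]
      linarith [Nat.cast_nonneg (α := ℝ) n]
    linarith

theorem expBounded_coeffY (n : ℕ) : ExpBounded (coeffY n) := by
  refine ⟨4, fun k => ?_⟩
  have h1 := cast_harmonic_nonneg k
  have h2 := cast_harmonic_nonneg (n + k)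
  have h3 := cast_harmonic_le k
  have h4 := cast_harmonic_le (n + k)
  have h5 := Real.one_half_lt_eulerMascheroniConstant
  have h6 := Real.eulerMascheroniConstant_lt_two_thirds
  -- Harmonic numbers are at most their index, so the digamma sum grows at most linearly in `n + k`;
  -- the factor `(n + k)!` in the denominator of `coeffJ` absorbs this.
  have hf : (n + k) + 1 ≤ 2 * (n + k)! := by
    have := Nat.self_le_factorial (n + k)
    have := Nat.factorial_pos (n + k)
    omega
  have hf' : ((n : ℝ) + k) + 1 ≤ 2 * ((n + k)! : ℝ) := by exact_mod_cast hf
  have hd : |digammaSum n k| ≤ 4 * ((n + k)! : ℝ) := by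
    rw [digammaSum, abs_le]
    push_cast at *
    have : (0 : ℝ) ≤ n := by positivity
    have : (0 : ℝ) ≤ k := by positivity
    constructor <;> linarith
  rw [coeffY, abs_mul, abs_coeffJ]
  have hk : (0 : ℝ) < (k ! : ℝ) := by positivity
  have hk' : (0 : ℝ) < ((n + k)! : ℝ) := by positivity
  calc |digammaSum n k| * (1 / ((k ! : ℝ) * ((n + k)! : ℝ)))
      ≤ 4 * ((n + k)! : ℝ) * (1 / ((k ! : ℝ) * ((n + k)! : ℝ))) := by gcongr
    _ = _ := by field_simp

theorem coeffJ_succ_left (n k : ℕ) : coeffJ n k = ((n : ℝ) + k + 1) * coeffJ (n + 1) k := by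
  rw [coeffJ, coeffJ, show n + 1 + k = n + k + 1 by ring, Nat.factorial_succ]
  push_cast
  have : (n : ℝ) + k + 1 ≠ 0 := by positivity
  field_simp

theorem coeffJ_succ_right (n k : ℕ) : ((k : ℝ) + 1) * coeffJ n (k + 1) = -coeffJ (n + 1) k := by
  rw [coeffJ, coeffJ, show n + 1 + k = n + (k + 1) by ring, Nat.factorial_succ k, pow_succ]
  push_cast
  have : (k : ℝ) + 1 ≠ 0 := by positivity
  field_simp

theorem digammaSum_succ_left (n k : ℕ) :
    digammaSum (n + 1) k = digammaSum n k + 1 / ((n : ℝ) + k + 1) := by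
  rw [digammaSum, digammaSum, show n + 1 + k = n + k + 1 by ring, cast_harmonic_succ]
  push_cast
  ring

theorem digammaSum_succ_right (n k : ℕ) :
    digammaSum n (k + 1) = digammaSum (n + 1) k + 1 / ((k : ℝ) + 1) := by
  rw [digammaSum, digammaSum, show n + 1 + k = n + (k + 1) by ring, cast_harmonic_succ k]
  ring

theorem besselJ_eq (n : ℕ) (z : ℝ) :
    besselJ n z = (z / 2) ^ n * powerSum (coeffJ n) ((z / 2) ^ 2) := by
  rw [besselJ, powerSum, ← tsum_mul_left]
  refine tsum_congr fun k => ?_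
  rw [coeffJ, pow_add, pow_mul]
  ring

theorem powerSum_coeffJ_recurrence (n : ℕ) (t : ℝ) :
    t * powerSum (coeffJ (n + 2)) t + powerSum (coeffJ n) t
      = ((n : ℝ) + 1) * powerSum (coeffJ (n + 1)) t := by
  rw [powerSum_three_term (c := (n : ℝ) + 1) (e := 0) (expBounded_coeffJ n)
    (expBounded_coeffJ (n + 1)), add_zero]
  · rw [coeffJ_succ_left]; simp
  · intro k
    have h1 := coeffJ_succ_right (n + 1) k
    have h2 := coeffJ_succ_left n (k + 1)
    push_cast at h2
    rw [show n + 2 = n + 1 + 1 from rfl]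
    linear_combination h2 + h1

theorem hasDerivAt_powerSum_coeffJ (n : ℕ) (t : ℝ) :
    HasDerivAt (powerSum (coeffJ n)) (-powerSum (coeffJ (n + 1)) t) t := by
  have h := (expBounded_coeffJ n).hasDerivAt t
  convert h using 1
  rw [← neg_one_mul, ← powerSum_const_mul]
  congr 1
  funext k
  rw [coeffJ_succ_right]
  ring

/-- Energy argument: by the recurrence, `P_n² + s P_{n+1}²` has derivative `-(2n + 1) P_{n+1}²`, so
on `[0, ∞)` it never exceeds its value `(1 / n!)²` at the origin. -/
theorem abs_powerSum_coeffJ_le (n : ℕ) {t : ℝ} (ht : 0 ≤ t) :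
    |powerSum (coeffJ n) t| ≤ 1 / (n ! : ℝ) := by
  set F := fun s => powerSum (coeffJ n) s ^ 2 + s * powerSum (coeffJ (n + 1)) s ^ 2 with hF
  have hd : ∀ s, HasDerivAt F (-(2 * (n : ℝ) + 1) * powerSum (coeffJ (n + 1)) s ^ 2) s := by
    intro s
    have h1 := (hasDerivAt_powerSum_coeffJ n s).pow 2
    have h2 := (hasDerivAt_id s).mul ((hasDerivAt_powerSum_coeffJ (n + 1) s).pow 2)
    refine (h1.add h2).congr_deriv ?_
    have h3 := powerSum_coeffJ_recurrence n s
    simp only [id, Pi.pow_apply]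
    push_cast
    linear_combination (-2 * powerSum (coeffJ (n + 1)) s) * h3
  have hanti : Antitone F := by
    refine antitone_of_hasDerivAt_nonpos hd fun s => ?_
    have : 0 ≤ (2 * (n : ℝ) + 1) * powerSum (coeffJ (n + 1)) s ^ 2 := by positivity
    change _ ≤ (0 : ℝ)
    linarith
  have h := hanti ht
  simp only [hF, powerSum_zero] at h
  have h0 : coeffJ n 0 = 1 / (n ! : ℝ) := by simp [coeffJ]
  rw [h0] at h
  refine abs_le_of_sq_le_sq ?_ (by positivity)
  nlinarith [mul_nonneg ht (sq_nonneg (powerSum (coeffJ (n + 1)) t))]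

theorem abs_besselJ_le (n : ℕ) {y : ℝ} (hy : 0 ≤ y) :
    |besselJ n y| ≤ (y / 2) ^ n / (n ! : ℝ) := by
  rw [besselJ_eq, abs_mul, abs_of_nonneg (by positivity), div_eq_mul_one_div ((y / 2) ^ n)]
  exact mul_le_mul_of_nonneg_left (abs_powerSum_coeffJ_le n (by positivity)) (by positivity)

/-! ### Neumann's expansion and the recurrence for `Y_n` -/

/-- The polynomial part of Neumann's expansion. -/
noncomputable def neumannPoly (n : ℕ) (t : ℝ) : ℝ :=
  ∑ k ∈ Finset.range n, ((n - k - 1)! : ℝ) / (k ! : ℝ) * t ^ k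

theorem pi_mul_besselY (n : ℕ) (z : ℝ) :
    Real.pi * besselY n z = -(((z / 2) ^ n)⁻¹ * neumannPoly n ((z / 2) ^ 2))
      + 2 * Real.log (z / 2) * ((z / 2) ^ n * powerSum (coeffJ n) ((z / 2) ^ 2))
      - (z / 2) ^ n * powerSum (coeffY n) ((z / 2) ^ 2) := by
  have hpi : Real.pi ≠ 0 := Real.pi_ne_zero
  have h1 : powerSum (coeffY n) ((z / 2) ^ 2) =
      ∑' k : ℕ, (((harmonic k : ℚ) : ℝ) + ((harmonic (n + k) : ℚ) : ℝ)
          - 2 * Real.eulerMascheroniConstant) *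
        ((-1 : ℝ) ^ k / ((k ! : ℝ) * ((n + k)! : ℝ)) * (z / 2) ^ (2 * k)) := by
    refine tsum_congr fun k => ?_
    rw [coeffY, digammaSum, coeffJ, pow_mul]
    ring
  have h2 : neumannPoly n ((z / 2) ^ 2) =
      ∑ k ∈ Finset.range n, ((n - k - 1)! : ℝ) / (k ! : ℝ) * (z / 2) ^ (2 * k) :=
    Finset.sum_congr rfl fun k _ => by rw [pow_mul]
  rw [besselY, ← h1, ← h2, besselJ_eq]
  field_simp

/-- The defect `t ^ (n + 1) / (n + 1)!` is what the digamma series fails by in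
`powerSum_coeffY_recurrence`; the two cancel in `besselY_recurrence`. -/
theorem neumannPoly_recurrence (n : ℕ) (t : ℝ) :
    neumannPoly (n + 2) t + t * neumannPoly n t
      = ((n : ℝ) + 1) * neumannPoly (n + 1) t + t ^ (n + 1) / ((n + 1)! : ℝ) := by
  have hlast : neumannPoly (n + 2) t = (∑ k ∈ Finset.range (n + 1),
      ((n + 2 - k - 1)! : ℝ) / (k ! : ℝ) * t ^ k) + t ^ (n + 1) / ((n + 1)! : ℝ) := by
    rw [neumannPoly, Finset.sum_range_succ]
    congr 1
    rw [show n + 2 - (n + 1) - 1 = 0 by omega]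
    simp
    ring
  rw [hlast, neumannPoly, neumannPoly, Finset.sum_range_succ', Finset.sum_range_succ' _ n,
    Finset.mul_sum, mul_add, Finset.mul_sum]
  have hterm : ∀ k ∈ Finset.range n,
      ((n + 2 - (k + 1) - 1)! : ℝ) / ((k + 1)! : ℝ) * t ^ (k + 1)
        + t * (((n - k - 1)! : ℝ) / (k ! : ℝ) * t ^ k)
      = ((n : ℝ) + 1) * (((n + 1 - (k + 1) - 1)! : ℝ) / ((k + 1)! : ℝ) * t ^ (k + 1)) := by
    intro k hk
    obtain ⟨d, rfl⟩ := Nat.exists_eq_add_of_lt (Finset.mem_range.1 hk)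
    rw [show k + d + 1 + 2 - (k + 1) - 1 = d + 1 by omega,
      show k + d + 1 - k - 1 = d by omega, show k + d + 1 + 1 - (k + 1) - 1 = d by omega,
      Nat.factorial_succ d, Nat.factorial_succ k]
    push_cast
    have : (k : ℝ) + 1 ≠ 0 := by positivity
    field_simp
    ring
  have hs := Finset.sum_congr rfl hterm
  rw [Finset.sum_add_distrib] at hs
  have h0 : ((n + 2 - 0 - 1)! : ℝ) / (0 ! : ℝ) * t ^ 0
      = ((n : ℝ) + 1) * (((n + 1 - 0 - 1)! : ℝ) / (0 ! : ℝ) * t ^ 0) := by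
    rw [show n + 2 - 0 - 1 = n + 1 by omega, show n + 1 - 0 - 1 = n by omega,
      Nat.factorial_succ]
    push_cast
    ring
  rw [h0]
  linear_combination hs

theorem powerSum_coeffY_recurrence (n : ℕ) (t : ℝ) :
    t * powerSum (coeffY (n + 2)) t + powerSum (coeffY n) t
      = ((n : ℝ) + 1) * powerSum (coeffY (n + 1)) t + -(1 / ((n + 1)! : ℝ)) := by
  refine powerSum_three_term (expBounded_coeffY n) (expBounded_coeffY (n + 1)) ?_ ?_ t
  · have h1 := coeffJ_succ_left n 0
    have h2 := digammaSum_succ_left n 0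
    have h3 : coeffJ (n + 1) 0 = 1 / ((n + 1)! : ℝ) := by simp [coeffJ]
    have : (n : ℝ) + 1 ≠ 0 := by positivity
    push_cast at h1 h2
    rw [coeffY, coeffY, h1, h2, ← h3]
    field_simp
    ring
  · intro k
    have h1 := coeffJ_succ_right (n + 1) k
    have h2 := coeffJ_succ_left n (k + 1)
    have h3 := digammaSum_succ_left n (k + 1)
    have h4 := digammaSum_succ_right (n + 1) k
    have : (k : ℝ) + 1 ≠ 0 := by positivity
    have : (n : ℝ) + ((k : ℝ) + 1) + 1 ≠ 0 := by positivity
    push_cast at h2 h3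
    have h1' : coeffJ (n + 2) k = -(((k : ℝ) + 1) * coeffJ (n + 1) (k + 1)) := by linarith
    have h4' : digammaSum (n + 2) k
        = digammaSum n (k + 1) + 1 / ((n : ℝ) + (k + 1) + 1) - 1 / ((k : ℝ) + 1) := by
      rw [← h3, h4]
      ring_nf
    rw [coeffY, coeffY, coeffY, h1', h2, h3, h4']
    field_simp
    ring

theorem besselY_recurrence (n : ℕ) {x : ℝ} (hx : 0 < x) :
    x * (besselY (n + 2) x + besselY n x) = 2 * ((n : ℝ) + 1) * besselY (n + 1) x := by
  have hpi : Real.pi ≠ 0 := Real.pi_ne_zero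
  refine mul_left_cancel₀ hpi ?_
  have e0 := pi_mul_besselY n x
  have e1 := pi_mul_besselY (n + 1) x
  have e2 := pi_mul_besselY (n + 2) x
  obtain ⟨w, rfl⟩ : ∃ w, x = 2 * w := ⟨x / 2, by ring⟩
  have hw : w ≠ 0 := by intro h; simp [h] at hx
  rw [show 2 * w / 2 = w by ring] at e0 e1 e2
  have hJ := powerSum_coeffJ_recurrence n (w ^ 2)
  have hY := powerSum_coeffY_recurrence n (w ^ 2)
  have hP := neumannPoly_recurrence n (w ^ 2)
  have hpow : (w ^ 2) ^ (n + 1) = w ^ n * w ^ n * w ^ 2 := by ring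
  rw [hpow] at hP
  calc Real.pi * (2 * w * (besselY (n + 2) (2 * w) + besselY n (2 * w)))
      = 2 * w * (Real.pi * besselY (n + 2) (2 * w) + Real.pi * besselY n (2 * w)) := by ring
    _ = 2 * ((n : ℝ) + 1) * (Real.pi * besselY (n + 1) (2 * w)) := by
        rw [e0, e1, e2]
        have hwn : w ^ n ≠ 0 := pow_ne_zero _ hw
        have i1 : (w ^ (n + 1))⁻¹ = (w ^ n)⁻¹ * w⁻¹ := by rw [pow_succ, mul_inv]
        have i2 : (w ^ (n + 2))⁻¹ = (w ^ n)⁻¹ * w⁻¹ * w⁻¹ := by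
          rw [pow_succ, pow_succ, mul_inv, mul_inv]
        rw [i1, i2, pow_succ w n, pow_add w n 2]
        have c1 : w * w⁻¹ = 1 := mul_inv_cancel₀ hw
        have c2 : w ^ n * (w ^ n)⁻¹ = 1 := mul_inv_cancel₀ hwn
        -- With powers and inverses turned into atoms, the goal is a polynomial identity modulo the
        -- three recurrences and the relations `c1`, `c2`.
        generalize (w ^ n)⁻¹ = v at *
        generalize w⁻¹ = u at *
        generalize w ^ n = W at *
        linear_combination (4 * Real.log w * w * W) * hJ - (2 * w * W) * hY - (2 * v * u) * hP
          + (-2 * v * u * neumannPoly (n + 2) (w ^ 2) + 2 * w * v * neumannPoly n (w ^ 2)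
              - 2 * w * W / ((n + 1)! : ℝ)) * c1
          - (2 * w * W / ((n + 1)! : ℝ) * w * u) * c2
    _ = _ := by ring

/-! ### The first-order system satisfied by `Y_0` and `Y_1` -/

theorem hasDerivAt_sq_half (x : ℝ) : HasDerivAt (fun z : ℝ => (z / 2) ^ 2) (x / 2) x := by
  have h := ((hasDerivAt_id x).div_const 2).pow 2
  exact h.congr_deriv (by simp; ring)

theorem hasDerivAt_log_half {x : ℝ} (hx : 0 < x) :
    HasDerivAt (fun z : ℝ => Real.log (z / 2)) (1 / x) x := by
  have h := ((hasDerivAt_id x).div_const 2).log (by simpa using hx.ne')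
  refine h.congr_deriv ?_
  have := hx.ne'
  change 1 / 2 / (x / 2) = 1 / x
  field_simp

theorem hasDerivAt_besselY_zero {x : ℝ} (hx : 0 < x) :
    HasDerivAt (besselY 0) (-besselY 1 x) x := by
  have hpi : Real.pi ≠ 0 := Real.pi_ne_zero
  have hf : besselY 0 = fun z => Real.pi⁻¹ *
      (2 * Real.log (z / 2) * powerSum (coeffJ 0) ((z / 2) ^ 2)
        - powerSum (coeffY 0) ((z / 2) ^ 2)) := by
    funext z
    have h := pi_mul_besselY 0 z
    rw [eq_inv_mul_iff_mul_eq₀ hpi, h]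
    simp [neumannPoly]
  set K' := powerSum (fun k => ((k : ℝ) + 1) * coeffY 0 (k + 1)) ((x / 2) ^ 2) with hK'
  have hJd := (hasDerivAt_powerSum_coeffJ 0 ((x / 2) ^ 2)).comp x (hasDerivAt_sq_half x)
  have hYd := ((expBounded_coeffY 0).hasDerivAt ((x / 2) ^ 2)).comp x (hasDerivAt_sq_half x)
  have hd := (((((hasDerivAt_log_half hx).const_mul 2).mul hJd).sub hYd).const_mul Real.pi⁻¹)
  -- This absorbs the term produced by differentiating the logarithm: coefficientwise it is the step
  -- `1 / (k + 1)` between `digammaSum 0 (k + 1)` and `digammaSum 1 k`.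
  have hrel : (x / 2) ^ 2 * (K' + powerSum (coeffY 1) ((x / 2) ^ 2))
      = powerSum (coeffJ 0) ((x / 2) ^ 2) - 1 := by
    rw [hK', ← (expBounded_coeffY 0).deriv.powerSum_add (expBounded_coeffY 1),
      (expBounded_coeffJ 0).powerSum_eq]
    have h0 : coeffJ 0 0 = 1 := by simp [coeffJ]
    rw [h0, add_sub_cancel_left]
    congr 2
    funext k
    have h1 := coeffJ_succ_right 0 k
    have h2 := digammaSum_succ_right 0 k
    have h1' : coeffJ (0 + 1) k = -(((k : ℝ) + 1) * coeffJ 0 (k + 1)) := by linarith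
    have : (k : ℝ) + 1 ≠ 0 := by positivity
    rw [coeffY, coeffY, h2, show (1 : ℕ) = 0 + 1 from rfl, h1']
    field_simp
    ring
  rw [hf]
  refine hd.congr_deriv ?_
  have h1 := pi_mul_besselY 1 x
  have hP : neumannPoly 1 ((x / 2) ^ 2) = 1 := by simp [neumannPoly]
  rw [hP] at h1
  rw [inv_mul_eq_iff_eq_mul₀ hpi, mul_neg, h1]
  have hx0 : x ≠ 0 := hx.ne'
  simp only [Function.comp_apply, zero_add]
  rw [← hK']
  simp only [div_pow] at hrel ⊢
  field_simp
  linear_combination (-4) * hrel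

theorem hasDerivAt_mul_besselY_one {x : ℝ} (hx : 0 < x) :
    HasDerivAt (fun z => z * besselY 1 z) (x * besselY 0 x) x := by
  have hpi : Real.pi ≠ 0 := Real.pi_ne_zero
  have hx0 : x ≠ 0 := hx.ne'
  have hf : ∀ z : ℝ, 0 < z → z * besselY 1 z = 2 * Real.pi⁻¹ *
      (-1 + (z / 2) ^ 2 * (2 * Real.log (z / 2) * powerSum (coeffJ 1) ((z / 2) ^ 2)
        - powerSum (coeffY 1) ((z / 2) ^ 2))) := by
    intro z hz
    have hz0 : z ≠ 0 := hz.ne'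
    have h := pi_mul_besselY 1 z
    have hP : neumannPoly 1 ((z / 2) ^ 2) = 1 := by simp [neumannPoly]
    rw [hP] at h
    field_simp
    field_simp at h
    linear_combination h
  set K' := powerSum (fun k => ((k : ℝ) + 1) * coeffY 1 (k + 1)) ((x / 2) ^ 2) with hK'
  have hsq := hasDerivAt_sq_half x
  have hJd := (hasDerivAt_powerSum_coeffJ 1 ((x / 2) ^ 2)).comp x hsq
  have hYd := ((expBounded_coeffY 1).hasDerivAt ((x / 2) ^ 2)).comp x hsq
  have hd := ((hsq.mul ((((hasDerivAt_log_half hx).const_mul 2).mul hJd).sub hYd)).const_add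
    (-1)).const_mul (2 * Real.pi⁻¹)
  have hrel : (x / 2) ^ 2 * K' + powerSum (coeffY 1) ((x / 2) ^ 2)
      = powerSum (coeffY 0) ((x / 2) ^ 2) + powerSum (coeffJ 1) ((x / 2) ^ 2) := by
    rw [← (expBounded_coeffY 0).powerSum_add (expBounded_coeffJ 1), hK',
      powerSum_three_term (c := 1) (e := 0) (expBounded_coeffY 1)
        ((expBounded_coeffY 0).add (expBounded_coeffJ 1)), one_mul, add_zero]
    · have h1 := coeffJ_succ_left 0 0
      have h2 := digammaSum_succ_left 0 0
      simp only [zero_add, Nat.cast_zero, one_mul, div_one] at h1 h2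
      rw [coeffY, coeffY, h1, h2]
      ring
    · intro k
      have h1 := coeffJ_succ_left 0 (k + 1)
      have h2 := digammaSum_succ_left 0 (k + 1)
      simp only [zero_add, Nat.cast_zero] at h1 h2
      push_cast at h1 h2
      have : (k : ℝ) + 1 + 1 ≠ 0 := by positivity
      rw [coeffY, coeffY, h1, h2]
      field_simp
  have hJ := powerSum_coeffJ_recurrence 0 ((x / 2) ^ 2)
  refine HasDerivAt.congr_of_eventuallyEq (f := fun z => 2 * Real.pi⁻¹ *
      (-1 + (z / 2) ^ 2 * (2 * Real.log (z / 2) * powerSum (coeffJ 1) ((z / 2) ^ 2)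
        - powerSum (coeffY 1) ((z / 2) ^ 2)))) ?_ ?_
  · refine hd.congr_deriv ?_
    have h0 := pi_mul_besselY 0 x
    have hP : neumannPoly 0 ((x / 2) ^ 2) = 0 := by simp [neumannPoly]
    rw [hP] at h0
    have h0' : besselY 0 x = Real.pi⁻¹ * (2 * Real.log (x / 2) * powerSum (coeffJ 0) ((x / 2) ^ 2)
        - powerSum (coeffY 0) ((x / 2) ^ 2)) := by
      rw [eq_inv_mul_iff_mul_eq₀ hpi, h0]
      simp
    rw [h0']
    simp only [Function.comp_apply, zero_add, Nat.cast_zero, one_mul, Pi.sub_apply,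
      Pi.mul_apply] at hJ hrel ⊢
    rw [← hK']
    have e1 : powerSum (coeffJ 0) ((x / 2) ^ 2) = powerSum (coeffJ 1) ((x / 2) ^ 2)
        - (x / 2) ^ 2 * powerSum (coeffJ 2) ((x / 2) ^ 2) := by linarith
    have e2 : powerSum (coeffY 0) ((x / 2) ^ 2) = (x / 2) ^ 2 * K'
        + powerSum (coeffY 1) ((x / 2) ^ 2) - powerSum (coeffJ 1) ((x / 2) ^ 2) := by linarith
    rw [e1, e2]
    norm_num
    field_simp
    ring
  · filter_upwards [lt_mem_nhds hx] with z hz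
    exact hf z hz

/-! ### Integrals against the kernel `exp (-x sinh t)` -/

/-- Continuous functions of at most exponential growth on `[0, ∞)`. -/
structure ExpGrowth (g : ℝ → ℝ) : Prop where
  continuous : Continuous g
  bound : ∃ C a : ℝ, ∀ t, 0 ≤ t → |g t| ≤ C * Real.exp (a * t)

/-- The integral of `g t * exp (-x sinh t)` over the positive half-line. -/
noncomputable def laplaceSinh (g : ℝ → ℝ) (x : ℝ) : ℝ :=
  ∫ t in Ioi (0 : ℝ), g t * Real.exp (-(x * Real.sinh t))

theorem sq_div_four_le_sinh {t : ℝ} (ht : 0 ≤ t) : t ^ 2 / 4 ≤ Real.sinh t := by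
  rw [Real.sinh_eq]
  have h1 := Real.quadratic_le_exp_of_nonneg ht
  have h2 : Real.exp (-t) ≤ 1 := Real.exp_le_one_iff.2 (by linarith)
  linarith

/-- Complete the square in `(a + 1) t - d t² / 4`. The bound is uniform in `x ≥ d`, which is what
differentiation under the integral needs. -/
theorem exp_mul_exp_neg_sinh_le (a : ℝ) {d x t : ℝ} (hd : 0 < d) (hx : d ≤ x) (ht : 0 ≤ t) :
    Real.exp (a * t) * Real.exp (-(x * Real.sinh t))
      ≤ Real.exp ((a + 1) ^ 2 / d) * Real.exp (-t) := by
  rw [← Real.exp_add, ← Real.exp_add, Real.exp_le_exp]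
  have h1 := sq_div_four_le_sinh ht
  have h2 : d * (t ^ 2 / 4) ≤ x * Real.sinh t := by
    apply mul_le_mul hx h1 (by positivity) (by linarith)
  have h3 : (a + 1) * t ≤ d * (t ^ 2 / 4) + (a + 1) ^ 2 / d := by
    have h4 : d * (t ^ 2 / 4) + (a + 1) ^ 2 / d - (a + 1) * t
        = (d * t / 2 - (a + 1)) ^ 2 / d := by field_simp; ring
    have h5 : 0 ≤ (d * t / 2 - (a + 1)) ^ 2 / d := by positivity
    linarith
  linarith

namespace ExpGrowth

variable {g h : ℝ → ℝ}

theorem const (c : ℝ) : ExpGrowth fun _ => c :=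
  ⟨continuous_const, |c|, 0, fun t _ => by simp⟩

theorem exp (c : ℝ) : ExpGrowth fun t => Real.exp (c * t) :=
  ⟨by fun_prop, 1, c, fun t _ => by rw [abs_of_pos (Real.exp_pos _), one_mul]⟩

theorem id : ExpGrowth fun t => t :=
  ⟨continuous_id, 1, 1, fun t ht => by
    rw [abs_of_nonneg ht]
    linarith [Real.add_one_le_exp (1 * t)]⟩

theorem mul (hg : ExpGrowth g) (hh : ExpGrowth h) : ExpGrowth fun t => g t * h t := by
  obtain ⟨C, a, h1⟩ := hg.bound
  obtain ⟨D, b, h2⟩ := hh.bound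
  refine ⟨hg.continuous.mul hh.continuous, C * D, a + b, fun t ht => ?_⟩
  rw [abs_mul, add_mul, Real.exp_add]
  calc |g t| * |h t| ≤ (C * Real.exp (a * t)) * (D * Real.exp (b * t)) :=
        mul_le_mul (h1 t ht) (h2 t ht) (abs_nonneg _) ((abs_nonneg _).trans (h1 t ht))
    _ = _ := by ring

theorem add (hg : ExpGrowth g) (hh : ExpGrowth h) : ExpGrowth fun t => g t + h t := by
  obtain ⟨C, a, h1⟩ := hg.bound
  obtain ⟨D, b, h2⟩ := hh.bound
  have hC : 0 ≤ C := by simpa using (abs_nonneg _).trans (h1 0 le_rfl)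
  have hD : 0 ≤ D := by simpa using (abs_nonneg _).trans (h2 0 le_rfl)
  refine ⟨hg.continuous.add hh.continuous, C + D, max a b, fun t ht => ?_⟩
  refine (abs_add_le _ _).trans ?_
  rw [add_mul]
  refine add_le_add ((h1 t ht).trans ?_) ((h2 t ht).trans ?_)
  · gcongr
    exact le_max_left _ _
  · gcongr
    exact le_max_right _ _

theorem const_mul (hg : ExpGrowth g) (c : ℝ) : ExpGrowth fun t => c * g t := (const c).mul hg

theorem sinh : ExpGrowth Real.sinh := by
  have h := ((exp 1).const_mul (1 / 2)).add ((exp (-1)).const_mul (-1 / 2))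
  convert h using 1
  funext t
  rw [Real.sinh_eq, one_mul, neg_one_mul]
  ring

theorem cosh : ExpGrowth Real.cosh := by
  have h := ((exp 1).const_mul (1 / 2)).add ((exp (-1)).const_mul (1 / 2))
  convert h using 1
  funext t
  rw [Real.cosh_eq, one_mul, neg_one_mul]
  ring

theorem exists_bound (hg : ExpGrowth g) {d : ℝ} (hd : 0 < d) :
    ∃ C : ℝ, ∀ x, d ≤ x → ∀ t, 0 ≤ t →
      |g t * Real.exp (-(x * Real.sinh t))| ≤ C * Real.exp (-t) := by
  obtain ⟨C, a, h1⟩ := hg.bound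
  have hC : 0 ≤ C := by simpa using (abs_nonneg _).trans (h1 0 le_rfl)
  refine ⟨C * Real.exp ((a + 1) ^ 2 / d), fun x hx t ht => ?_⟩
  rw [abs_mul, abs_of_pos (Real.exp_pos (-(x * Real.sinh t)))]
  calc |g t| * Real.exp (-(x * Real.sinh t))
      ≤ C * Real.exp (a * t) * Real.exp (-(x * Real.sinh t)) := by gcongr; exact h1 t ht
    _ = C * (Real.exp (a * t) * Real.exp (-(x * Real.sinh t))) := by ring
    _ ≤ C * (Real.exp ((a + 1) ^ 2 / d) * Real.exp (-t)) := by
        gcongr C * ?_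
        exact exp_mul_exp_neg_sinh_le a hd hx ht
    _ = _ := by ring

theorem continuous_integrand (hg : ExpGrowth g) (x : ℝ) :
    Continuous fun t => g t * Real.exp (-(x * Real.sinh t)) :=
  hg.continuous.mul (by fun_prop)

theorem integrableOn (hg : ExpGrowth g) {x : ℝ} (hx : 0 < x) :
    IntegrableOn (fun t => g t * Real.exp (-(x * Real.sinh t))) (Ioi 0) := by
  obtain ⟨C, hC⟩ := hg.exists_bound hx
  refine Integrable.mono' ((integrableOn_exp_neg_Ioi 0).const_mul C)
    (hg.continuous_integrand x).aestronglyMeasurable ?_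
  filter_upwards [ae_restrict_mem measurableSet_Ioi] with t ht
  exact hC x le_rfl t (le_of_lt ht)

theorem tendsto_zero (hg : ExpGrowth g) {x : ℝ} (hx : 0 < x) :
    Tendsto (fun t => g t * Real.exp (-(x * Real.sinh t))) atTop (𝓝 0) := by
  obtain ⟨C, hC⟩ := hg.exists_bound hx
  refine squeeze_zero_norm' (a := fun t => C * Real.exp (-t)) ?_ ?_
  · filter_upwards [eventually_ge_atTop 0] with t ht
    exact hC x le_rfl t ht
  · simpa using (Real.tendsto_exp_neg_atTop_nhds_zero).const_mul C

theorem laplaceSinh_add (hg : ExpGrowth g) (hh : ExpGrowth h) {x : ℝ} (hx : 0 < x) :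
    laplaceSinh (fun t => g t + h t) x = laplaceSinh g x + laplaceSinh h x := by
  rw [laplaceSinh, laplaceSinh, laplaceSinh,
    ← integral_add (hg.integrableOn hx) (hh.integrableOn hx)]
  simp only [add_mul]

theorem hasDerivAt_laplaceSinh (hg : ExpGrowth g) {x : ℝ} (hx : 0 < x) :
    HasDerivAt (laplaceSinh g) (-laplaceSinh (fun t => g t * Real.sinh t) x) x := by
  have hgs := hg.mul sinh
  obtain ⟨C, hC⟩ := hgs.exists_bound (half_pos hx)
  have h := (hasDerivAt_integral_of_dominated_loc_of_deriv_le (μ := volume.restrict (Ioi (0 : ℝ)))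
    (F := fun x t => g t * Real.exp (-(x * Real.sinh t)))
    (F' := fun x t => -(g t * Real.sinh t * Real.exp (-(x * Real.sinh t))))
    (s := Ici (x / 2)) (x₀ := x) (bound := fun t => C * Real.exp (-t))
    (Ici_mem_nhds (half_lt_self hx)) ?_ (hg.integrableOn hx) ?_ ?_ ?_ ?_).2
  · refine h.congr_deriv ?_
    rw [integral_neg, laplaceSinh]
  · exact Eventually.of_forall fun y => (hg.continuous_integrand y).aestronglyMeasurable
  · exact (hgs.continuous_integrand x).neg.aestronglyMeasurable
  · filter_upwards [ae_restrict_mem measurableSet_Ioi] with t ht y hy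
    rw [norm_neg]
    exact hC y hy t (le_of_lt ht)
  · exact (integrableOn_exp_neg_Ioi 0).const_mul C
  · refine Eventually.of_forall fun t y _ => ?_
    have h1 := (((hasDerivAt_id y).mul_const (Real.sinh t)).neg.exp).const_mul (g t)
    refine h1.congr_deriv ?_
    simp only [Pi.neg_apply, _root_.id]
    ring

/-- Integration by parts against the kernel `exp (-x sinh t)`. -/
theorem laplaceSinh_deriv (hg : ExpGrowth g) (hh : ExpGrowth h)
    (hd : ∀ t, HasDerivAt g (h t) t) {x : ℝ} (hx : 0 < x) :
    laplaceSinh h x = x * laplaceSinh (fun t => g t * Real.cosh t) x - g 0 := by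
  have hgc := hg.mul cosh
  have key := integral_Ioi_of_hasDerivAt_of_tendsto' (a := 0) (m := 0)
    (f := fun t => g t * Real.exp (-(x * Real.sinh t)))
    (f' := fun t => h t * Real.exp (-(x * Real.sinh t))
      - x * (g t * Real.cosh t * Real.exp (-(x * Real.sinh t)))) ?_
    ((hh.integrableOn hx).sub ((hgc.integrableOn hx).const_mul x)) (hg.tendsto_zero hx)
  · rw [integral_sub (hh.integrableOn hx) ((hgc.integrableOn hx).const_mul x),
      integral_const_mul] at key
    simp only [Real.sinh_zero, mul_zero, neg_zero, Real.exp_zero, mul_one] at key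
    rw [laplaceSinh, laplaceSinh]
    linarith
  · intro t _
    have h1 := (hd t).mul (((Real.hasDerivAt_sinh t).const_mul x).neg.exp)
    refine h1.congr_deriv ?_
    simp only [Pi.neg_apply]
    ring

end ExpGrowth

theorem laplaceSinh_const_mul (g : ℝ → ℝ) (c x : ℝ) :
    laplaceSinh (fun t => c * g t) x = c * laplaceSinh g x := by
  rw [laplaceSinh, laplaceSinh, ← integral_const_mul]
  simp only [mul_assoc]

theorem laplaceSinh_nonneg {g : ℝ → ℝ} (hg : ∀ t, 0 < t → 0 ≤ g t) (x : ℝ) :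
    0 ≤ laplaceSinh g x :=
  setIntegral_nonneg measurableSet_Ioi fun t ht => mul_nonneg (hg t ht) (Real.exp_pos _).le

/-! ### The improper Schläfli integral -/

/-- The kernel of the improper part of Schläfli's integral for `Y_n`. -/
noncomputable def schlafliKernel (n : ℕ) (t : ℝ) : ℝ :=
  Real.exp (n * t) + (-1) ^ n * Real.exp (-(n * t))

theorem schlafliKernel_zero (t : ℝ) : schlafliKernel 0 t = 2 := by
  simp [schlafliKernel]
  norm_num

theorem schlafliKernel_one (t : ℝ) : schlafliKernel 1 t = 2 * Real.sinh t := by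
  rw [schlafliKernel, Real.sinh_eq]
  simp
  ring

theorem expGrowth_exp_comb (a c : ℝ) :
    ExpGrowth fun t => Real.exp (a * t) + c * Real.exp (-(a * t)) := by
  simpa only [neg_mul] using (ExpGrowth.exp a).add ((ExpGrowth.exp (-a)).const_mul c)

theorem expGrowth_schlafliKernel (n : ℕ) : ExpGrowth (schlafliKernel n) :=
  expGrowth_exp_comb n _

theorem schlafliKernel_nonneg (n : ℕ) {t : ℝ} (ht : 0 < t) : 0 ≤ schlafliKernel n t := by
  rw [schlafliKernel]
  have h1 : Real.exp (-(n * t)) ≤ Real.exp (n * t) := by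
    rw [Real.exp_le_exp]
    have : 0 ≤ n * t := by positivity
    linarith
  have h2 := Real.exp_pos (-(n * t))
  rcases neg_one_pow_eq_or ℝ n with h | h <;> rw [h] <;> linarith

theorem laplaceSinh_schlafliKernel_recurrence (n : ℕ) {x : ℝ} (hx : 0 < x) :
    x * (laplaceSinh (schlafliKernel (n + 2)) x + laplaceSinh (schlafliKernel n) x)
      = 2 * ((n : ℝ) + 1) * laplaceSinh (schlafliKernel (n + 1)) x + 2 * (1 + (-1) ^ n) := by
  -- Up to the factor `n + 1`, `g` is a primitive of the kernel of order `n + 1`, and `2 g cosh` is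
  -- the sum of its two neighbours. The boundary value `g 0` gives the inhomogeneous term, which
  -- also occurs in `schlafliTrig_recurrence` and so cancels in the difference.
  set g : ℝ → ℝ := fun t => Real.exp (((n : ℝ) + 1) * t)
    + (-1) ^ n * Real.exp (-(((n : ℝ) + 1) * t)) with hg
  have hgrow : ExpGrowth g := expGrowth_exp_comb _ _
  have hd : ∀ t, HasDerivAt g (((n : ℝ) + 1) * schlafliKernel (n + 1) t) t := by
    intro t
    have h0 : HasDerivAt (fun t : ℝ => ((n : ℝ) + 1) * t) ((n : ℝ) + 1) t := by
      simpa using (hasDerivAt_id t).const_mul ((n : ℝ) + 1)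
    have h1 := h0.exp.add ((h0.neg.exp).const_mul ((-1) ^ n))
    refine h1.congr_deriv ?_
    rw [schlafliKernel]
    simp only [Pi.neg_apply]
    push_cast
    ring
  have key := hgrow.laplaceSinh_deriv ((expGrowth_schlafliKernel (n + 1)).const_mul _) hd hx
  rw [laplaceSinh_const_mul, mul_comm x] at key
  have hsum : (fun t => schlafliKernel (n + 2) t + schlafliKernel n t)
      = fun t => 2 * (g t * Real.cosh t) := by
    funext t
    simp only [hg, schlafliKernel]
    rw [Real.cosh_eq]
    push_cast
    have e1 : Real.exp (((n : ℝ) + 2) * t) = Real.exp (((n : ℝ) + 1) * t) * Real.exp t := by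
      rw [← Real.exp_add]; ring_nf
    have e2 : Real.exp ((n : ℝ) * t) = Real.exp (((n : ℝ) + 1) * t) * Real.exp (-t) := by
      rw [← Real.exp_add]; ring_nf
    have e3 : Real.exp (-(((n : ℝ) + 2) * t))
        = Real.exp (-(((n : ℝ) + 1) * t)) * Real.exp (-t) := by
      rw [← Real.exp_add]; ring_nf
    have e4 : Real.exp (-((n : ℝ) * t)) = Real.exp (-(((n : ℝ) + 1) * t)) * Real.exp t := by
      rw [← Real.exp_add]; ring_nf
    rw [e1, e2, e3, e4]
    ring
  rw [← (expGrowth_schlafliKernel (n + 2)).laplaceSinh_add (expGrowth_schlafliKernel n) hx,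
    hsum, laplaceSinh_const_mul]
  have h0 : g 0 = 1 + (-1) ^ n := by simp [hg]
  rw [h0] at key
  linear_combination (-2) * key

theorem laplaceSinh_one_sub_deriv {x : ℝ} (hx : 0 < x) :
    laplaceSinh (schlafliKernel 1) x - x * laplaceSinh (fun t => schlafliKernel 1 t * Real.sinh t) x
      = x * laplaceSinh (schlafliKernel 0) x - 2 := by
  have hgrow : ExpGrowth fun t => 2 * Real.cosh t := ExpGrowth.cosh.const_mul 2
  have key := hgrow.laplaceSinh_deriv (expGrowth_schlafliKernel 1)
    (fun t => by rw [schlafliKernel_one]; exact (Real.hasDerivAt_cosh t).const_mul 2) hx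
  have hsum : (fun t => schlafliKernel 1 t * Real.sinh t + schlafliKernel 0 t)
      = fun t => 2 * Real.cosh t * Real.cosh t := by
    funext t
    rw [schlafliKernel_one, schlafliKernel_zero]
    nlinarith [Real.cosh_sq t]
  rw [key, ← hsum, ((expGrowth_schlafliKernel 1).mul ExpGrowth.sinh).laplaceSinh_add
    (expGrowth_schlafliKernel 0) hx, Real.cosh_zero]
  ring

theorem hasDerivAt_laplaceSinh_schlafliKernel_zero {x : ℝ} (hx : 0 < x) :
    HasDerivAt (laplaceSinh (schlafliKernel 0)) (-laplaceSinh (schlafliKernel 1) x) x := by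
  have h := (expGrowth_schlafliKernel 0).hasDerivAt_laplaceSinh hx
  have e : (fun t => schlafliKernel 0 t * Real.sinh t) = schlafliKernel 1 := by
    funext t
    rw [schlafliKernel_zero, schlafliKernel_one]
  rwa [e] at h

theorem hasDerivAt_mul_laplaceSinh_schlafliKernel_one {x : ℝ} (hx : 0 < x) :
    HasDerivAt (fun z => z * laplaceSinh (schlafliKernel 1) z)
      (x * laplaceSinh (schlafliKernel 0) x - 2) x := by
  have h := (hasDerivAt_id x).mul ((expGrowth_schlafliKernel 1).hasDerivAt_laplaceSinh hx)
  refine h.congr_deriv ?_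
  rw [← laplaceSinh_one_sub_deriv hx]
  simp only [id]
  ring

/-! ### The proper Schläfli integral -/

/-- The proper part of Schläfli's integral for `Y_n`. -/
noncomputable def schlafliTrig (n : ℕ) (x : ℝ) : ℝ :=
  ∫ θ in (0 : ℝ)..Real.pi, Real.sin (x * Real.sin θ - n * θ)

theorem continuous_schlafliTrig (n : ℕ) : Continuous (schlafliTrig n) :=
  intervalIntegral.continuous_parametric_intervalIntegral_of_continuous' (by fun_prop) _ _

theorem hasDerivAt_schlafliTrig (n : ℕ) (x : ℝ) :
    HasDerivAt (schlafliTrig n)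
      (∫ θ in (0 : ℝ)..Real.pi, Real.cos (x * Real.sin θ - n * θ) * Real.sin θ) x := by
  refine (intervalIntegral.hasDerivAt_integral_of_dominated_loc_of_deriv_le
    (F := fun x θ => Real.sin (x * Real.sin θ - n * θ))
    (F' := fun x θ => Real.cos (x * Real.sin θ - n * θ) * Real.sin θ)
    (s := univ) (bound := fun _ => 1) univ_mem ?_ ?_ ?_ ?_ ?_ ?_).2
  · exact Eventually.of_forall fun y => Continuous.aestronglyMeasurable (by fun_prop)
  · exact Continuous.intervalIntegrable (by fun_prop) _ _
  · exact Continuous.aestronglyMeasurable (by fun_prop)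
  · refine Eventually.of_forall fun t _ y _ => ?_
    rw [Real.norm_eq_abs, abs_mul]
    exact mul_le_one₀ (Real.abs_cos_le_one _) (abs_nonneg _) (Real.abs_sin_le_one _)
  · exact intervalIntegrable_const
  · refine Eventually.of_forall fun t _ y _ => ?_
    have h1 := ((((hasDerivAt_id y).mul_const (Real.sin t)).sub_const ((n : ℝ) * t)).sin)
    refine h1.congr_deriv ?_
    simp

theorem schlafliTrig_recurrence (n : ℕ) (x : ℝ) :
    x * (schlafliTrig (n + 2) x + schlafliTrig n x)
      = 2 * ((n : ℝ) + 1) * schlafliTrig (n + 1) x + 2 * (1 + (-1) ^ n) := by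
  have hi : ∀ k : ℕ, IntervalIntegrable (fun θ => Real.sin (x * Real.sin θ - k * θ))
      volume 0 Real.pi := fun k => Continuous.intervalIntegrable (by fun_prop) _ _
  have key := intervalIntegral.integral_eq_sub_of_hasDerivAt (a := 0) (b := Real.pi)
    (f := fun θ => -2 * Real.cos (x * Real.sin θ - ((n : ℝ) + 1) * θ))
    (f' := fun θ => x * (Real.sin (x * Real.sin θ - (n + 2 : ℕ) * θ)
        + Real.sin (x * Real.sin θ - n * θ))
      - 2 * ((n : ℝ) + 1) * Real.sin (x * Real.sin θ - (n + 1 : ℕ) * θ)) ?_ ?_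
  · rw [intervalIntegral.integral_sub (((hi _).add (hi _)).const_mul _) ((hi _).const_mul _),
      intervalIntegral.integral_const_mul, intervalIntegral.integral_const_mul,
      intervalIntegral.integral_add (hi _) (hi _)] at key
    have hc : Real.cos (x * Real.sin Real.pi - ((n : ℝ) + 1) * Real.pi) = -(-1) ^ n := by
      rw [Real.sin_pi, mul_zero, zero_sub, Real.cos_neg]
      have := Real.cos_nat_mul_pi (n + 1)
      push_cast at this
      rw [this, pow_succ]
      ring
    simp only [hc, Real.sin_zero, mul_zero, sub_zero, Real.cos_zero] at key
    simp only [schlafliTrig]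
    linarith
  · intro θ _
    have h1 := ((((Real.hasDerivAt_sin θ).const_mul x).sub
      ((hasDerivAt_id θ).const_mul ((n : ℝ) + 1))).cos).const_mul (-2)
    refine h1.congr_deriv ?_
    simp only [Pi.sub_apply, id]
    push_cast
    have e1 : Real.sin (x * Real.sin θ - ((n : ℝ) + 2) * θ)
        = Real.sin (x * Real.sin θ - ((n : ℝ) + 1) * θ) * Real.cos θ
          - Real.cos (x * Real.sin θ - ((n : ℝ) + 1) * θ) * Real.sin θ := by
      rw [← Real.sin_sub]
      congr 1
      ring
    have e2 : Real.sin (x * Real.sin θ - (n : ℝ) * θ)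
        = Real.sin (x * Real.sin θ - ((n : ℝ) + 1) * θ) * Real.cos θ
          + Real.cos (x * Real.sin θ - ((n : ℝ) + 1) * θ) * Real.sin θ := by
      rw [← Real.sin_add]
      congr 1
      ring
    rw [e1, e2]
    ring
  · exact (((hi _).add (hi _)).const_mul _).sub ((hi _).const_mul _)

theorem hasDerivAt_schlafliTrig_zero {x : ℝ} (hx : 0 < x) :
    HasDerivAt (schlafliTrig 0) (-schlafliTrig 1 x) x := by
  refine (hasDerivAt_schlafliTrig 0 x).congr_deriv ?_
  -- The two integrands add up to `sin(x sin θ) cos θ`, an exact derivative whose primitive agrees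
  -- at `0` and `π`.
  have key := intervalIntegral.integral_eq_sub_of_hasDerivAt (a := 0) (b := Real.pi)
    (f := fun θ => -Real.cos (x * Real.sin θ) / x)
    (f' := fun θ => Real.cos (x * Real.sin θ - (0 : ℕ) * θ) * Real.sin θ
      + Real.sin (x * Real.sin θ - (1 : ℕ) * θ)) ?_
    (Continuous.intervalIntegrable (by fun_prop) _ _)
  · rw [intervalIntegral.integral_add (Continuous.intervalIntegrable (by fun_prop) _ _)
      (Continuous.intervalIntegrable (by fun_prop) _ _)] at key
    simp only [Real.sin_pi, Real.sin_zero, sub_self] at key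
    rw [schlafliTrig]
    linarith
  · intro θ _
    have h1 := ((((Real.hasDerivAt_sin θ).const_mul x).cos).neg).div_const x
    refine h1.congr_deriv ?_
    have := hx.ne'
    push_cast
    rw [zero_mul, sub_zero, one_mul, Real.sin_sub]
    field_simp
    ring

theorem hasDerivAt_mul_schlafliTrig_one (x : ℝ) :
    HasDerivAt (fun z => z * schlafliTrig 1 z) (x * schlafliTrig 0 x - 2) x := by
  refine ((hasDerivAt_id x).mul (hasDerivAt_schlafliTrig 1 x)).congr_deriv ?_
  have hi1 : IntervalIntegrable (fun θ => Real.sin (x * Real.sin θ - (1 : ℕ) * θ))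
      volume 0 Real.pi := Continuous.intervalIntegrable (by fun_prop) _ _
  have hi2 : IntervalIntegrable (fun θ => Real.cos (x * Real.sin θ - (1 : ℕ) * θ) * Real.sin θ)
      volume 0 Real.pi := Continuous.intervalIntegrable (by fun_prop) _ _
  have hi3 : IntervalIntegrable (fun θ => Real.sin (x * Real.sin θ - (0 : ℕ) * θ))
      volume 0 Real.pi := Continuous.intervalIntegrable (by fun_prop) _ _
  have key := intervalIntegral.integral_eq_sub_of_hasDerivAt (a := 0) (b := Real.pi)
    (f := fun θ => Real.cos (x * Real.sin θ - θ))
    (f' := fun θ => Real.sin (x * Real.sin θ - (1 : ℕ) * θ)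
      + x * (Real.cos (x * Real.sin θ - (1 : ℕ) * θ) * Real.sin θ)
      - x * Real.sin (x * Real.sin θ - (0 : ℕ) * θ)) ?_
    ((hi1.add (hi2.const_mul x)).sub (hi3.const_mul x))
  · rw [intervalIntegral.integral_sub (hi1.add (hi2.const_mul x)) (hi3.const_mul x),
      intervalIntegral.integral_add hi1 (hi2.const_mul x),
      intervalIntegral.integral_const_mul, intervalIntegral.integral_const_mul] at key
    simp only [Real.sin_pi, Real.sin_zero, mul_zero, sub_zero, zero_sub, Real.cos_neg,
      Real.cos_pi, Real.cos_zero] at key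
    simp only [schlafliTrig, id]
    linarith
  · intro θ _
    have h1 := (((Real.hasDerivAt_sin θ).const_mul x).sub (hasDerivAt_id θ)).cos
    refine h1.congr_deriv ?_
    simp only [Pi.sub_apply, id]
    push_cast
    rw [zero_mul, sub_zero, one_mul]
    have e2 : Real.sin (x * Real.sin θ) = Real.sin (x * Real.sin θ - θ) * Real.cos θ
        + Real.cos (x * Real.sin θ - θ) * Real.sin θ := by
      rw [← Real.sin_add, sub_add_cancel]
    rw [e2]
    ring

/-! ### Behaviour at the origin -/

/-- This is `Γ'(1) = -γ`, with the Gamma integral differentiated under the integral sign. -/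
theorem integral_log_mul_exp_neg :
    ∫ t in Ioi (0 : ℝ), Real.log t * Real.exp (-t) = -Real.eulerMascheroniConstant := by
  have h1 := Complex.hasDerivAt_GammaIntegral (s := 1) (by simp)
  have h2 : HasDerivAt Complex.GammaIntegral (-(Real.eulerMascheroniConstant : ℂ)) 1 := by
    refine Complex.hasDerivAt_Gamma_one.congr_of_eventuallyEq ?_
    have ho : IsOpen {s : ℂ | 0 < s.re} := Complex.continuous_re.isOpen_preimage _ isOpen_Ioi
    filter_upwards [ho.mem_nhds (show (1 : ℂ) ∈ {s : ℂ | 0 < s.re} by simp)] with s hs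
    exact (Complex.Gamma_eq_integral hs).symm
  have h3 := h1.unique h2
  simp only [sub_self, Complex.cpow_zero, one_mul] at h3
  have h4 : ∫ t in Ioi (0 : ℝ), ((Real.log t : ℂ) * (Real.exp (-t) : ℂ))
      = ((∫ t in Ioi (0 : ℝ), Real.log t * Real.exp (-t) : ℝ) : ℂ) := by
    have h5 := integral_ofReal (𝕜 := ℂ) (μ := volume.restrict (Ioi (0 : ℝ)))
      (f := fun t => Real.log t * Real.exp (-t))
    simpa using h5
  rw [h4] at h3
  exact_mod_cast h3

theorem integrableOn_log_mul_exp_neg :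
    IntegrableOn (fun t : ℝ => Real.log t * Real.exp (-t)) (Ioi 0) := by
  -- The integral of a non-integrable function is `0` by convention, so a nonzero value proves
  -- integrability.
  refine Integrable.of_integral_ne_zero ?_
  rw [integral_log_mul_exp_neg, neg_ne_zero]
  exact (by linarith [Real.one_half_lt_eulerMascheroniConstant] :
    (0 : ℝ) < Real.eulerMascheroniConstant).ne'

theorem integrableOn_self_mul_exp_neg :
    IntegrableOn (fun t : ℝ => t * Real.exp (-t)) (Ioi 0) := by
  have h := Real.GammaIntegral_convergent (s := 2) (by norm_num)
  refine h.congr_fun (fun t _ => ?_) measurableSet_Ioi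
  norm_num
  ring

theorem integrableOn_arsinh_div_mul_exp_neg {x : ℝ} (hx : 0 < x) :
    IntegrableOn (fun u : ℝ => Real.arsinh (u / x) * Real.exp (-u)) (Ioi 0) := by
  refine Integrable.mono' (integrableOn_self_mul_exp_neg.const_mul x⁻¹)
    ((Real.continuous_arsinh.comp (continuous_id.div_const x)).mul
      (by fun_prop)).aestronglyMeasurable ?_
  filter_upwards [ae_restrict_mem measurableSet_Ioi] with u hu
  have hu0 : 0 ≤ u / x := div_nonneg (le_of_lt hu) hx.le
  have h1 : 0 ≤ Real.arsinh (u / x) := Real.arsinh_nonneg_iff.2 hu0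
  have h2 : Real.arsinh (u / x) ≤ u / x := by
    have := Real.self_le_sinh_iff.2 h1
    rwa [Real.sinh_arsinh] at this
  rw [Real.norm_eq_abs, abs_of_nonneg (mul_nonneg h1 (Real.exp_pos _).le)]
  calc Real.arsinh (u / x) * Real.exp (-u) ≤ u / x * Real.exp (-u) := by gcongr
    _ = _ := by ring

/-- Integrate by parts, then substitute `u = x sinh t`: the `x`-dependence moves into `arsinh (u /
x)`, whose singularity as `x → 0` is exactly `-log x`. -/
theorem laplaceSinh_one_eq {x : ℝ} (hx : 0 < x) :
    laplaceSinh (fun _ => 1) x = ∫ u in Ioi (0 : ℝ), Real.arsinh (u / x) * Real.exp (-u) := by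
  have hx0 := hx.ne'
  rw [ExpGrowth.id.laplaceSinh_deriv (ExpGrowth.const 1) hasDerivAt_id hx, sub_zero]
  have hsub := integral_comp_mul_deriv_Ioi (a := 0) (f := fun t => x * Real.sinh t)
    (f' := fun t => x * Real.cosh t) (g := fun u => Real.arsinh (u / x) * Real.exp (-u))
    (by fun_prop) ?_ ?_ ?_ ?_ ?_
  · simp only [Real.sinh_zero, mul_zero] at hsub
    rw [← hsub, laplaceSinh, ← integral_const_mul]
    refine setIntegral_congr_fun measurableSet_Ioi fun t _ => ?_
    simp only [Function.comp_apply, mul_div_cancel_left₀ _ hx0, Real.arsinh_sinh]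
    ring
  · exact Real.sinhOrderIso.tendsto_atTop.const_mul_atTop hx
  · exact fun t _ => ((Real.hasDerivAt_sinh t).const_mul x).hasDerivWithinAt
  · exact ((Real.continuous_arsinh.comp (continuous_id.div_const x)).mul
      (by fun_prop)).continuousOn
  · have himg : (fun t => x * Real.sinh t) '' Ici 0 ⊆ Ici 0 := by
      rintro _ ⟨t, ht, rfl⟩
      exact mul_nonneg hx.le (Real.sinh_nonneg_iff.2 ht)
    refine IntegrableOn.mono_set ?_ himg
    rw [integrableOn_Ici_iff_integrableOn_Ioi]
    exact integrableOn_arsinh_div_mul_exp_neg hx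
  · rw [integrableOn_Ici_iff_integrableOn_Ioi]
    refine IntegrableOn.congr_fun
      (((ExpGrowth.id.mul ExpGrowth.cosh).integrableOn hx).const_mul x)
      (fun t _ => ?_) measurableSet_Ioi
    simp only [Function.comp_apply, mul_div_cancel_left₀ _ hx0, Real.arsinh_sinh]
    ring

theorem arsinh_div_add_log {x u : ℝ} (hx : 0 < x) (hu : 0 < u) :
    Real.arsinh (u / x) + Real.log x = Real.log (u + √(x ^ 2 + u ^ 2)) := by
  have hpos : 0 < u / x + √(1 + (u / x) ^ 2) := by positivity
  rw [Real.arsinh, ← Real.log_mul hpos.ne' hx.ne']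
  congr 1
  have h1 : √(x ^ 2 + u ^ 2) = √(1 + (u / x) ^ 2) * x := by
    rw [show x ^ 2 + u ^ 2 = (1 + (u / x) ^ 2) * x ^ 2 by field_simp,
      Real.sqrt_mul (by positivity), Real.sqrt_sq hx.le]
  rw [h1, add_mul, div_mul_cancel₀ _ hx.ne']

theorem tendsto_laplaceSinh_one_add_log :
    Tendsto (fun x => laplaceSinh (fun _ => 1) x + Real.log x) (𝓝[>] 0)
      (𝓝 (Real.log 2 - Real.eulerMascheroniConstant)) := by
  have hexp : IntegrableOn (fun u : ℝ => Real.exp (-u)) (Ioi 0) := integrableOn_exp_neg_Ioi 0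
  have hlim : ∫ u in Ioi (0 : ℝ), Real.log (2 * u) * Real.exp (-u)
      = Real.log 2 - Real.eulerMascheroniConstant := by
    have e : ∀ u ∈ Ioi (0 : ℝ), Real.log (2 * u) * Real.exp (-u)
        = Real.log 2 * Real.exp (-u) + Real.log u * Real.exp (-u) := by
      intro u hu
      rw [Real.log_mul two_ne_zero (ne_of_gt hu)]
      ring
    rw [setIntegral_congr_fun measurableSet_Ioi e,
      integral_add (hexp.const_mul _) integrableOn_log_mul_exp_neg, integral_const_mul,
      integral_exp_neg_Ioi_zero, integral_log_mul_exp_neg]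
    ring
  rw [← hlim]
  have hT : Tendsto (fun x => ∫ u in Ioi (0 : ℝ), Real.log (u + √(x ^ 2 + u ^ 2)) * Real.exp (-u))
      (𝓝[>] 0) (𝓝 (∫ u in Ioi (0 : ℝ), Real.log (2 * u) * Real.exp (-u))) := by
    -- For `0 < x < 1` the argument of the logarithm lies between `2u` and `2u + 1`, which yields
    -- the dominating function.
    refine tendsto_integral_filter_of_dominated_convergence
      (fun u => Real.log 2 * Real.exp (-u) + |Real.log u * Real.exp (-u)|
        + 2 * (u * Real.exp (-u))) ?_ ?_
      (((hexp.const_mul _).add integrableOn_log_mul_exp_neg.abs).add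
        (integrableOn_self_mul_exp_neg.const_mul 2)) ?_
    · exact Eventually.of_forall fun x => Measurable.aestronglyMeasurable (by fun_prop)
    · filter_upwards [Ioo_mem_nhdsGT (zero_lt_one' ℝ)] with x hx
      filter_upwards [ae_restrict_mem measurableSet_Ioi] with u hu
      have hu' : 0 < u := hu
      have hx0 : 0 < x := hx.1
      have hs1 : u ≤ √(x ^ 2 + u ^ 2) := Real.le_sqrt_of_sq_le (by nlinarith)
      have hs2 : √(x ^ 2 + u ^ 2) ≤ u + 1 := by
        rw [Real.sqrt_le_left (by linarith)]
        nlinarith [hx.2]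
      have h1 : Real.log 2 + Real.log u ≤ Real.log (u + √(x ^ 2 + u ^ 2)) := by
        rw [← Real.log_mul two_ne_zero hu'.ne']
        exact Real.log_le_log (by linarith) (by linarith)
      have h2 : Real.log (u + √(x ^ 2 + u ^ 2)) ≤ 2 * u := by
        have := Real.log_le_sub_one_of_pos (show 0 < u + √(x ^ 2 + u ^ 2) by positivity)
        linarith
      have h3 : 0 < Real.log 2 := Real.log_pos one_lt_two
      have h4 : |Real.log (u + √(x ^ 2 + u ^ 2))| ≤ Real.log 2 + |Real.log u| + 2 * u := by
        rw [abs_le]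
        have := neg_abs_le (Real.log u)
        have := abs_nonneg (Real.log u)
        constructor <;> linarith
      rw [Real.norm_eq_abs, abs_mul, abs_mul, abs_of_pos (Real.exp_pos (-u))]
      calc _ ≤ (Real.log 2 + |Real.log u| + 2 * u) * Real.exp (-u) := by gcongr
        _ = _ := by ring
    · filter_upwards [ae_restrict_mem measurableSet_Ioi] with u hu
      have hu' : 0 < u := hu
      have hc : ContinuousAt (fun x : ℝ => Real.log (u + √(x ^ 2 + u ^ 2)) * Real.exp (-u)) 0 := by
        refine ContinuousAt.mul (ContinuousAt.log (by fun_prop) ?_) continuousAt_const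
        positivity
      have h := hc.tendsto.mono_left (nhdsWithin_le_nhds (s := Ioi 0))
      convert h using 3
      rw [zero_pow two_ne_zero, zero_add, Real.sqrt_sq hu'.le, two_mul]
  refine hT.congr' ?_
  filter_upwards [self_mem_nhdsWithin] with x hx
  have hx' : 0 < x := hx
  have e : ∀ u ∈ Ioi (0 : ℝ), Real.log (u + √(x ^ 2 + u ^ 2)) * Real.exp (-u)
      = Real.arsinh (u / x) * Real.exp (-u) + Real.log x * Real.exp (-u) := by
    intro u hu
    rw [← arsinh_div_add_log hx' hu]
    ring
  rw [setIntegral_congr_fun measurableSet_Ioi e, integral_add (integrableOn_arsinh_div_mul_exp_neg hx') (hexp.const_mul _),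
    integral_const_mul, integral_exp_neg_Ioi_zero, ← laplaceSinh_one_eq hx', mul_one]

theorem tendsto_laplaceSinh_exp_neg :
    Tendsto (laplaceSinh fun t => Real.exp (-t)) (𝓝[>] 0) (𝓝 1) := by
  rw [← integral_exp_neg_Ioi_zero]
  refine tendsto_integral_filter_of_dominated_convergence (fun t => Real.exp (-t)) ?_ ?_
    (integrableOn_exp_neg_Ioi 0) ?_
  · exact Eventually.of_forall fun x => Continuous.aestronglyMeasurable (by fun_prop)
  · filter_upwards [self_mem_nhdsWithin] with x hx
    filter_upwards [ae_restrict_mem measurableSet_Ioi] with t ht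
    rw [Real.norm_eq_abs, abs_of_nonneg (by positivity)]
    refine mul_le_of_le_one_right (Real.exp_pos _).le (Real.exp_le_one_iff.2 ?_)
    exact neg_nonpos.2 (mul_nonneg (le_of_lt hx) (Real.sinh_nonneg_iff.2 (le_of_lt ht)))
  · refine Eventually.of_forall fun t => ?_
    have hc : Continuous fun x : ℝ => Real.exp (-t) * Real.exp (-(x * Real.sinh t)) := by fun_prop
    have h := (hc.tendsto 0).mono_left (nhdsWithin_le_nhds (s := Ioi 0))
    simpa using h

theorem tendsto_besselY_zero_sub_log :
    Tendsto (fun x => Real.pi * besselY 0 x - 2 * Real.log (x / 2)) (𝓝[>] 0)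
      (𝓝 (2 * Real.eulerMascheroniConstant)) := by
  -- Since `J_0 - 1` is divisible by `(x / 2) ^ 2`, one factor `x / 2` can be attached to the
  -- logarithm, leaving a function continuous at `0`.
  have e : ∀ x : ℝ, Real.pi * besselY 0 x - 2 * Real.log (x / 2)
      = 2 * (x / 2 * Real.log (x / 2))
          * (x / 2 * powerSum (fun k => coeffJ 0 (k + 1)) ((x / 2) ^ 2))
        - powerSum (coeffY 0) ((x / 2) ^ 2) := by
    intro x
    have h0 : coeffJ 0 0 = 1 := by simp [coeffJ]
    rw [pi_mul_besselY, (expBounded_coeffJ 0).powerSum_eq, h0, neumannPoly, Finset.sum_range_zero]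
    ring
  simp only [e]
  have hc1 := (expBounded_coeffJ 0).shift.continuous
  have hc2 := (expBounded_coeffY 0).continuous
  have hc3 := Real.continuous_mul_log
  have hc : Continuous fun x : ℝ => 2 * (x / 2 * Real.log (x / 2))
          * (x / 2 * powerSum (fun k => coeffJ 0 (k + 1)) ((x / 2) ^ 2))
        - powerSum (coeffY 0) ((x / 2) ^ 2) := by
    have hc4 : Continuous fun x : ℝ => x / 2 * Real.log (x / 2) :=
      hc3.comp (continuous_id.div_const 2)
    fun_prop
  have h := (hc.tendsto 0).mono_left (nhdsWithin_le_nhds (s := Ioi 0))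
  convert h using 2
  norm_num [powerSum_zero, coeffY, digammaSum, coeffJ]

theorem tendsto_besselY_one_add_inv :
    Tendsto (fun x => Real.pi * besselY 1 x + 2 / x) (𝓝[>] 0) (𝓝 0) := by
  have e : ∀ x : ℝ, Real.pi * besselY 1 x + 2 / x
      = 2 * (x / 2 * Real.log (x / 2)) * powerSum (coeffJ 1) ((x / 2) ^ 2)
        - x / 2 * powerSum (coeffY 1) ((x / 2) ^ 2) := by
    intro x
    have hP : neumannPoly 1 ((x / 2) ^ 2) = 1 := by simp [neumannPoly]
    rw [pi_mul_besselY, hP, pow_one, inv_div]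
    ring
  simp only [e]
  have hc1 := (expBounded_coeffJ 1).continuous
  have hc2 := (expBounded_coeffY 1).continuous
  have hc : Continuous fun x : ℝ => 2 * (x / 2 * Real.log (x / 2))
        * powerSum (coeffJ 1) ((x / 2) ^ 2) - x / 2 * powerSum (coeffY 1) ((x / 2) ^ 2) := by
    have hc4 : Continuous fun x : ℝ => x / 2 * Real.log (x / 2) :=
      Real.continuous_mul_log.comp (continuous_id.div_const 2)
    fun_prop
  have h := (hc.tendsto 0).mono_left (nhdsWithin_le_nhds (s := Ioi 0))
  simpa using h

/-! ### Uniqueness at the origin and Schläfli's formula -/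

/-- Solutions of the first-order system of Bessel's equation of order zero that vanish at the
origin are trivial. -/
theorem eq_zero_of_bessel_system {u v : ℝ → ℝ}
    (hu : ∀ x, 0 < x → HasDerivAt u (-v x) x)
    (hv : ∀ x, 0 < x → HasDerivAt (fun z => z * v z) (x * u x) x)
    (hu0 : Tendsto u (𝓝[>] 0) (𝓝 0)) (hv0 : Tendsto v (𝓝[>] 0) (𝓝 0)) {x : ℝ} (hx : 0 < x) :
    u x = 0 ∧ v x = 0 := by
  -- The cross terms cancel in `F' = -2 v² / z ≤ 0`, so `F` is at most its limit `0` at the origin.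
  set F : ℝ → ℝ := fun z => u z ^ 2 + v z ^ 2 with hF
  have hv' : ∀ z, 0 < z → HasDerivAt v (u z - v z / z) z := by
    intro z hz
    have h := (hv z hz).div (hasDerivAt_id z) hz.ne'
    have h2 := h.congr_of_eventuallyEq (f₁ := v) (by
      filter_upwards [lt_mem_nhds hz] with s hs
      have := hs.ne'
      simp only [Pi.div_apply, id]
      field_simp)
    refine h2.congr_deriv ?_
    have := hz.ne'
    simp only [id]
    field_simp
  have hd : ∀ z, 0 < z → HasDerivAt F (-(2 * v z ^ 2 / z)) z := by
    intro z hz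
    refine (((hu z hz).pow 2).add ((hv' z hz).pow 2)).congr_deriv ?_
    have := hz.ne'
    push_cast
    field_simp
    ring
  have hanti : AntitoneOn F (Ioi 0) := by
    refine antitoneOn_of_deriv_nonpos (convex_Ioi 0)
      (fun z hz => (hd z hz).continuousAt.continuousWithinAt)
      (fun z hz => (hd z (interior_subset hz)).differentiableAt.differentiableWithinAt)
      fun z hz => ?_
    have hz' : 0 < z := interior_subset hz
    rw [(hd z hz').deriv]
    have : 0 ≤ 2 * v z ^ 2 / z := by positivity
    linarith
  have hF0 : Tendsto F (𝓝[>] 0) (𝓝 0) := by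
    simpa using (hu0.pow 2).add (hv0.pow 2)
  have hle : F x ≤ 0 := by
    refine ge_of_tendsto hF0 ?_
    filter_upwards [Ioo_mem_nhdsGT hx] with s hs
    exact hanti hs.1 hx hs.2.le
  simp only [hF] at hle
  constructor <;> nlinarith [sq_nonneg (u x), sq_nonneg (v x)]

/-- Schläfli's integral for `Y_n`. -/
theorem pi_mul_besselY_eq_schlafli (n : ℕ) {x : ℝ} (hx : 0 < x) :
    Real.pi * besselY n x = schlafliTrig n x - laplaceSinh (schlafliKernel n) x := by
  have base := eq_zero_of_bessel_system
    (u := fun x => schlafliTrig 0 x - laplaceSinh (schlafliKernel 0) x - Real.pi * besselY 0 x)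
    (v := fun x => schlafliTrig 1 x - laplaceSinh (schlafliKernel 1) x - Real.pi * besselY 1 x)
    ?_ ?_ ?_ ?_ hx
  · induction n using Nat.twoStepInduction with
    | zero => linarith [base.1]
    | one => linarith [base.2]
    | more n ih1 ih2 =>
      have h1 := besselY_recurrence n hx
      have h2 := schlafliTrig_recurrence n x
      have h3 := laplaceSinh_schlafliKernel_recurrence n hx
      refine mul_left_cancel₀ hx.ne' ?_
      linear_combination Real.pi * h1 - h2 + h3 - x * ih1 + 2 * ((n : ℝ) + 1) * ih2
  · intro z hz
    refine (((hasDerivAt_schlafliTrig_zero hz).sub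
      (hasDerivAt_laplaceSinh_schlafliKernel_zero hz)).sub
        ((hasDerivAt_besselY_zero hz).const_mul Real.pi)).congr_deriv ?_
    ring
  · intro z hz
    have h := (((hasDerivAt_mul_schlafliTrig_one z).sub
      (hasDerivAt_mul_laplaceSinh_schlafliKernel_one hz)).sub
        ((hasDerivAt_mul_besselY_one hz).const_mul Real.pi))
    refine (h.congr_of_eventuallyEq (Eventually.of_forall fun s => ?_)).congr_deriv ?_
    · simp only [Pi.sub_apply]
      ring
    · ring
  · have hA := ((continuous_schlafliTrig 0).tendsto 0).mono_left
      (nhdsWithin_le_nhds (s := Ioi 0))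
    have hA0 : schlafliTrig 0 0 = 0 := by simp [schlafliTrig]
    rw [hA0] at hA
    have h := (hA.sub (tendsto_laplaceSinh_one_add_log.const_mul 2)).sub
      (tendsto_besselY_zero_sub_log.add_const (-2 * Real.log 2))
    rw [show (0 : ℝ) - 2 * (Real.log 2 - Real.eulerMascheroniConstant)
      - (2 * Real.eulerMascheroniConstant + -2 * Real.log 2) = 0 by ring] at h
    refine h.congr' ?_
    filter_upwards [self_mem_nhdsWithin] with z hz
    have hB : laplaceSinh (schlafliKernel 0) z = 2 * laplaceSinh (fun _ => 1) z := by
      rw [← laplaceSinh_const_mul]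
      congr 1
      funext t
      rw [schlafliKernel_zero, mul_one]
    rw [hB, Real.log_div (ne_of_gt hz) two_ne_zero]
    ring
  · have hA := ((continuous_schlafliTrig 1).tendsto 0).mono_left
      (nhdsWithin_le_nhds (s := Ioi 0))
    have hA0 : schlafliTrig 1 0 = -2 := by
      simp [schlafliTrig]
      norm_num
    rw [hA0] at hA
    have h := (hA.add (tendsto_laplaceSinh_exp_neg.const_mul 2)).sub tendsto_besselY_one_add_inv
    rw [show (-2 : ℝ) + 2 * 1 - 0 = 0 by ring] at h
    refine h.congr' ?_
    filter_upwards [self_mem_nhdsWithin] with z hz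
    have hz' : 0 < z := hz
    have hgrow : ExpGrowth fun t => Real.exp (-t) := by simpa using ExpGrowth.exp (-1)
    -- The `cosh` part integrates exactly to `1 / z` and matches the pole of `Y_1`; the `exp (-t)`
    -- part tends to `1` and offsets `schlafliTrig 1 0 = -2`.
    have hB : laplaceSinh (schlafliKernel 1) z
        = 2 * laplaceSinh Real.cosh z - 2 * laplaceSinh (fun t => Real.exp (-t)) z := by
      have h1 : schlafliKernel 1 = fun t => 2 * Real.cosh t + (-2) * Real.exp (-t) := by
        funext t
        rw [schlafliKernel_one, Real.sinh_eq, Real.cosh_eq]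
        ring
      rw [h1, (ExpGrowth.cosh.const_mul 2).laplaceSinh_add (hgrow.const_mul (-2)) hz',
        laplaceSinh_const_mul, laplaceSinh_const_mul]
      ring
    have hC : z * laplaceSinh Real.cosh z = 1 := by
      have h1 := (ExpGrowth.const 1).laplaceSinh_deriv (ExpGrowth.const 0)
        (fun t => hasDerivAt_const t 1) hz'
      have h2 : laplaceSinh (fun _ => 0) z = 0 := by simp [laplaceSinh]
      rw [h2] at h1
      simp only [one_mul] at h1
      linarith
    have hC' : laplaceSinh Real.cosh z = 1 / z := by
      rw [eq_div_iff hz'.ne']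
      linarith
    rw [hB, hC']
    ring

/-! ### The sign of `Y_n` up to the turning point -/

/-- The sign of the proper part of Schläfli's integral below the turning point. -/
theorem schlafliTrig_nonpos_of_lt {n : ℕ} {x : ℝ} (hx0 : 0 ≤ x) (hx : x < n) :
    schlafliTrig n x ≤ 0 := by
  set w : ℝ → ℝ := fun θ => n * θ - x * Real.sin θ with hw
  set w' : ℝ → ℝ := fun θ => n - x * Real.cos θ with hw'
  have hpos : ∀ θ, 0 < w' θ := by
    intro θ
    have := mul_le_mul_of_nonneg_left (Real.cos_le_one θ) hx0
    simp only [hw']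
    linarith
  have hne : ∀ θ, w' θ ≠ 0 := fun θ => (hpos θ).ne'
  have hdw : ∀ θ, HasDerivAt w (w' θ) θ := by
    intro θ
    refine (((hasDerivAt_id θ).const_mul (n : ℝ)).sub
      ((Real.hasDerivAt_sin θ).const_mul x)).congr_deriv ?_
    simp [hw']
  have hdw' : ∀ θ, HasDerivAt w' (x * Real.sin θ) θ := by
    intro θ
    refine (((Real.hasDerivAt_cos θ).const_mul x).const_sub (n : ℝ)).congr_deriv ?_
    ring
  have hcw : Continuous w := by fun_prop
  have hcw' : Continuous w' := by fun_prop
  have hcd : Continuous fun θ =>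
      (1 - Real.cos (w θ)) * (x * Real.sin θ) / w' θ ^ 2 :=
    Continuous.div (by fun_prop) (by fun_prop) fun θ => pow_ne_zero _ (hne θ)
  -- Integration by parts of `sin w = (w' sin w) / w'` with primitive `1 - cos w` of `w' sin w`: the
  -- boundary term is nonnegative, and so is the remaining integral because `w'' = x sin θ ≥ 0` on
  -- `[0, π]`.
  have key := intervalIntegral.integral_eq_sub_of_hasDerivAt (a := 0) (b := Real.pi)
    (f := fun θ => (1 - Real.cos (w θ)) / w' θ)
    (f' := fun θ => Real.sin (w θ) - (1 - Real.cos (w θ)) * (x * Real.sin θ) / w' θ ^ 2) ?_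
    (Continuous.intervalIntegrable (by fun_prop) _ _)
  · rw [intervalIntegral.integral_sub (Continuous.intervalIntegrable (by fun_prop) _ _)
      (hcd.intervalIntegrable _ _)] at key
    have h1 : 0 ≤ ∫ θ in (0 : ℝ)..Real.pi,
        (1 - Real.cos (w θ)) * (x * Real.sin θ) / w' θ ^ 2 := by
      refine intervalIntegral.integral_nonneg Real.pi_pos.le fun θ hθ => ?_
      have h2 := Real.sin_nonneg_of_mem_Icc hθ
      have h3 : 0 ≤ 1 - Real.cos (w θ) := by linarith [Real.cos_le_one (w θ)]
      positivity
    have h4 : 0 ≤ (1 - Real.cos (w Real.pi)) / w' Real.pi :=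
      div_nonneg (by linarith [Real.cos_le_one (w Real.pi)]) (hpos _).le
    have h5 : (1 - Real.cos (w 0)) / w' 0 = 0 := by simp [hw]
    have h6 : schlafliTrig n x = -∫ θ in (0 : ℝ)..Real.pi, Real.sin (w θ) := by
      rw [schlafliTrig, ← intervalIntegral.integral_neg]
      simp only [hw, ← Real.sin_neg, neg_sub]
    rw [h6]
    rw [h5] at key
    linarith
  · intro θ _
    refine (((hdw θ).cos.const_sub 1).div (hdw' θ) (hne θ)).congr_deriv ?_
    have := hne θ
    field_simp

/-- At `x = n` the phase derivative vanishes at `θ = 0`, so the endpoint is reached by continuity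
from the left. -/
theorem schlafliTrig_nonpos {n : ℕ} {x : ℝ} (hx0 : 0 < x) (hx : x ≤ n) :
    schlafliTrig n x ≤ 0 := by
  have h := ((continuous_schlafliTrig n).tendsto x).mono_left (nhdsWithin_le_nhds (s := Iio x))
  refine le_of_tendsto h ?_
  filter_upwards [Ioo_mem_nhdsLT hx0] with s hs
  exact schlafliTrig_nonpos_of_lt hs.1.le (hs.2.trans_le hx)

/-- `Y_n` is nonpositive up to the turning point. -/
theorem besselY_nonpos {n : ℕ} {x : ℝ} (hx0 : 0 < x) (hx : x ≤ n) : besselY n x ≤ 0 := by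
  have h1 := pi_mul_besselY_eq_schlafli n hx0
  have h2 := schlafliTrig_nonpos hx0 hx
  have h3 := laplaceSinh_nonneg (fun t ht => schlafliKernel_nonneg n ht) x
  exact nonpos_of_mul_nonpos_right (by linarith) Real.pi_pos

theorem besselC_nonneg {n : ℕ} {x : ℝ} (hx0 : 0 < x) (hx : x ≤ n) : 0 ≤ besselC n x := by
  have h := besselY_nonpos hx0 hx
  have hn : (0 : ℝ) < n := hx0.trans_le hx
  have := Real.Gamma_pos_of_pos hn
  have := Real.pi_pos
  have h' : 0 ≤ -besselY n x := by linarith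
  rw [besselC]
  positivity

/-! ### Monotonicity of `C_n` and the bound for `Y_n` -/

theorem besselC_succ (n : ℕ) (x : ℝ) :
    besselC (n + 1) x = -besselY (n + 1) x * (x / 2) ^ (n + 1) * (Real.pi / (n ! : ℝ)) := by
  rw [besselC]
  push_cast
  rw [Real.Gamma_nat_eq_factorial]

theorem besselC_succ_le {n : ℕ} {x : ℝ} (hx0 : 0 < x) (hx : x ≤ n) :
    besselC (n + 2) x ≤ besselC (n + 1) x := by
  have h1 := besselY_recurrence n hx0
  have h2 := besselY_nonpos hx0 hx
  have hn : (n : ℝ) + 1 ≠ 0 := by positivity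
  have hf : (n ! : ℝ) ≠ 0 := by positivity
  rw [besselC_succ, besselC_succ, Nat.factorial_succ]
  push_cast
  -- By the recurrence the difference of consecutive `C`'s is a positive multiple of `-Y_n(x)`.
  have e : -besselY (n + 1) x * (x / 2) ^ (n + 1) * (Real.pi / (n ! : ℝ))
      - -besselY (n + 1 + 1) x * (x / 2) ^ (n + 1 + 1) * (Real.pi / (((n : ℝ) + 1) * (n ! : ℝ)))
      = -besselY n x * (x / 2) ^ (n + 2) * (Real.pi / (((n : ℝ) + 1) * (n ! : ℝ))) := by
    rw [pow_succ (x / 2) (n + 1)]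
    field_simp
    linear_combination h1
  have h3 : 0 ≤ -besselY n x := by linarith
  have := Real.pi_pos
  have h4 : 0 ≤ -besselY n x * (x / 2) ^ (n + 2) * (Real.pi / (((n : ℝ) + 1) * (n ! : ℝ))) := by
    positivity
  linarith

theorem besselC_le_of_le {q n : ℕ} {x : ℝ} (hx0 : 0 < x) (hx : x ≤ q) (hn : q ≤ n) :
    besselC (n + 1) x ≤ besselC (q + 1) x := by
  induction n, hn using Nat.le_induction with
  | base => exact le_rfl
  | succ n hn ih =>
    exact (besselC_succ_le hx0 (hx.trans (by exact_mod_cast hn))).trans ih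

theorem abs_besselY_succ_le {q n : ℕ} {x : ℝ} (hx0 : 0 < x) (hx : x ≤ q) (hn : q ≤ n) :
    |besselY (n + 1) x| ≤ besselC (q + 1) x * (n ! : ℝ) / (Real.pi * (x / 2) ^ (n + 1)) := by
  have h1 : x ≤ ((n + 1 : ℕ) : ℝ) := by
    have : (q : ℝ) ≤ ((n + 1 : ℕ) : ℝ) := by exact_mod_cast hn.trans (Nat.le_succ n)
    linarith
  have h2 := besselY_nonpos hx0 h1
  have h3 := besselC_le_of_le hx0 hx hn
  rw [besselC_succ n] at h3
  have := Real.pi_pos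
  have hf : (0 : ℝ) < (n ! : ℝ) := by positivity
  rw [abs_of_nonpos h2, le_div_iff₀ (by positivity)]
  rw [mul_div_assoc', div_le_iff₀ hf] at h3
  linarith

/-! ### Factorial estimates -/

/-- The inequality between arithmetic and geometric means for `(a + 1) ⋯ (a + j)`. -/
theorem two_pow_mul_factorial_add_le (a j : ℕ) :
    2 ^ j * (a + j)! ≤ a ! * (2 * a + j + 1) ^ j := by
  induction j using Nat.twoStepInduction generalizing a with
  | zero => simp
  | one =>
    rw [Nat.factorial_succ]
    apply le_of_eq
    ring
  | more j ih _ =>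
    -- Peel off the outermost factors `a + 1` and `a + j + 2`: their sum `2a + j + 3` is the same
    -- for every such pair, and four times their product is at most its square.
    have h := ih (a + 1)
    rw [show 2 * (a + 1) + j + 1 = 2 * a + (j + 2) + 1 by ring, Nat.factorial_succ a] at h
    rw [show a + (j + 2) = (a + 1 + j) + 1 by ring, Nat.factorial_succ (a + 1 + j)]
    calc 2 ^ (j + 2) * ((a + 1 + j + 1) * (a + 1 + j)!)
        = 4 * (a + 1 + j + 1) * (2 ^ j * (a + 1 + j)!) := by ring
      _ ≤ 4 * (a + 1 + j + 1) * ((a + 1) * a ! * (2 * a + (j + 2) + 1) ^ j) := by gcongr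
      _ = (4 * (a + 1 + j + 1) * (a + 1)) * (a ! * (2 * a + (j + 2) + 1) ^ j) := by ring
      _ ≤ (2 * a + (j + 2) + 1) ^ 2 * (a ! * (2 * a + (j + 2) + 1) ^ j) := by
          gcongr
          nlinarith [sq_nonneg (j + 1 : ℤ)]
      _ = _ := by ring

theorem two_pow_mul_factorial_div_le (p m : ℕ) :
    2 ^ m * (((p + m)! : ℝ) / ((p + 1)! : ℝ))
      ≤ 2 * (2 * (p : ℝ) + (m : ℝ) + 2) ^ ((m : ℤ) - 1) := by
  have hf : (0 : ℝ) < ((p + 1)! : ℝ) := by positivity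
  rw [mul_div_assoc', div_le_iff₀ hf]
  cases m with
  | zero =>
    -- The exponent is `-1` here, and the bound is the equality `1 / (p + 1) = 2 / (2p + 2)`.
    apply le_of_eq
    have hp : (p : ℝ) + 1 ≠ 0 := by positivity
    have hp' : 2 * (p : ℝ) + 2 ≠ 0 := by positivity
    rw [Nat.factorial_succ]
    push_cast
    rw [zpow_neg_one, add_zero, add_zero]
    field_simp
  | succ j =>
    have h := two_pow_mul_factorial_add_le (p + 1) j
    have h' : (2 : ℝ) ^ j * ((p + 1 + j)! : ℝ)
        ≤ ((p + 1)! : ℝ) * (2 * ((p : ℝ) + 1) + j + 1) ^ j := by exact_mod_cast h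
    have e1 : ((j + 1 : ℕ) : ℤ) - 1 = (j : ℤ) := by push_cast; ring
    have e2 : 2 * (p : ℝ) + ((j + 1 : ℕ) : ℝ) + 2 = 2 * ((p : ℝ) + 1) + j + 1 := by
      push_cast; ring
    rw [e1, e2, zpow_natCast, show p + (j + 1) = p + 1 + j by ring, pow_succ]
    linarith

theorem factorial_div_le_two_pow {p m : ℕ} (hm : m ≤ p + 2) (k : ℕ) :
    ((p + k + m)! : ℝ) / ((p + 1 + k)! : ℝ)
      ≤ 2 ^ k * (((p + m)! : ℝ) / ((p + 1)! : ℝ)) := by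
  induction k with
  | zero => simp
  | succ k ih =>
    have hf : (0 : ℝ) < ((p + 1 + k)! : ℝ) := by positivity
    have hm' : (m : ℝ) ≤ (p : ℝ) + 2 := by exact_mod_cast hm
    have hr : ((p : ℝ) + k + m + 1) / ((p : ℝ) + 1 + k + 1) ≤ 2 := by
      rw [div_le_iff₀ (by positivity)]
      have : (0 : ℝ) ≤ p := by positivity
      have : (0 : ℝ) ≤ k := by positivity
      linarith
    rw [show p + (k + 1) + m = p + k + m + 1 by ring,
      show p + 1 + (k + 1) = p + 1 + k + 1 by ring, Nat.factorial_succ, Nat.factorial_succ]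
    push_cast
    rw [mul_div_mul_comm, pow_succ', mul_assoc]
    exact mul_le_mul hr ih (by positivity) (by norm_num)

/-! ### The termwise geometric bound and its sum -/

theorem abs_besselJ_mul_abs_besselY_le {m p : ℕ} {x y : ℝ} (hx0 : 0 < x) (hy0 : 0 ≤ y)
    (hm : m ≤ p + 2) (hxp : x ≤ p) (k : ℕ) :
    |besselJ (p + 1 + k) y| * |besselY (p + 1 + k + m) x| ≤
      2 * (2 * (p : ℝ) + (m : ℝ) + 2) ^ ((m : ℤ) - 1) * besselC (p + m + 1) x
        * (y / x) ^ (p + 1) / (Real.pi * x ^ m) * (2 * (y / x)) ^ k := by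
  have hxq : x ≤ ((p + m : ℕ) : ℝ) := by
    push_cast
    have : (0 : ℝ) ≤ m := by positivity
    linarith
  have hC : 0 ≤ besselC (p + m + 1) x := by
    refine besselC_nonneg hx0 ?_
    push_cast at hxq ⊢
    linarith
  have hJ := abs_besselJ_le (p + 1 + k) hy0
  -- The base order is `q = p + m`, so the constant is `C_{p+m+1}`; the monotonicity needs `x ≤ q`,
  -- which follows from `x ≤ p`.
  have hY := abs_besselY_succ_le hx0 hxq (show p + m ≤ p + k + m by omega)
  rw [show p + k + m + 1 = p + 1 + k + m by ring] at hY
  have hpi := Real.pi_pos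
  calc |besselJ (p + 1 + k) y| * |besselY (p + 1 + k + m) x|
      ≤ ((y / 2) ^ (p + 1 + k) / ((p + 1 + k)! : ℝ)) * (besselC (p + m + 1) x
          * ((p + k + m)! : ℝ) / (Real.pi * (x / 2) ^ (p + 1 + k + m))) :=
        mul_le_mul hJ hY (abs_nonneg _) (by positivity)
    _ = (besselC (p + m + 1) x * (y / x) ^ (p + 1 + k) / (Real.pi * x ^ m) * 2 ^ m)
          * (((p + k + m)! : ℝ) / ((p + 1 + k)! : ℝ)) := by
        have hf : ((p + 1 + k)! : ℝ) ≠ 0 := by positivity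
        rw [pow_add (x / 2) (p + 1 + k) m]
        simp only [div_pow]
        field_simp
    _ ≤ (besselC (p + m + 1) x * (y / x) ^ (p + 1 + k) / (Real.pi * x ^ m) * 2 ^ m)
          * (2 ^ k * (((p + m)! : ℝ) / ((p + 1)! : ℝ))) := by
        gcongr ?_ * ?_
        exact factorial_div_le_two_pow hm k
    _ = (besselC (p + m + 1) x * (y / x) ^ (p + 1 + k) / (Real.pi * x ^ m) * 2 ^ k)
          * (2 ^ m * (((p + m)! : ℝ) / ((p + 1)! : ℝ))) := by ring
    _ ≤ (besselC (p + m + 1) x * (y / x) ^ (p + 1 + k) / (Real.pi * x ^ m) * 2 ^ k)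
          * (2 * (2 * (p : ℝ) + (m : ℝ) + 2) ^ ((m : ℤ) - 1)) := by
        gcongr ?_ * ?_
        exact two_pow_mul_factorial_div_le p m
    _ = _ := by
        rw [pow_add (y / x) (p + 1) k, mul_pow]
        ring

theorem lemma8 (m p : ℕ) (x y : ℝ) (hy : 0 ≤ 2 * y) (hxy : 2 * y < x)
    (hp : max ((m : ℝ) - 2) x ≤ (p : ℝ)) :
    Summable (fun k : ℕ => |besselJ (p + 1 + k) y| * |besselY (p + 1 + k + m) x|) ∧
    ∑' k : ℕ, |besselJ (p + 1 + k) y| * |besselY (p + 1 + k + m) x| ≤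
      2 * (2 * (p : ℝ) + (m : ℝ) + 2) ^ ((m : ℤ) - 1) * besselC (p + m + 1) x
          * (y / x) ^ (p + 1)
        / (Real.pi * x ^ m * (1 - 2 * (y / x))) := by
  have hx0 : 0 < x := lt_of_le_of_lt hy hxy
  have hy0 : 0 ≤ y := by linarith
  have hm : m ≤ p + 2 := by
    have h := (le_max_left _ _).trans hp
    have h' : (m : ℝ) ≤ ((p + 2 : ℕ) : ℝ) := by
      push_cast
      linarith
    exact_mod_cast h'
  have hr0 : 0 ≤ 2 * (y / x) := by positivity
  have hr1 : 2 * (y / x) < 1 := by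
    rw [mul_div_assoc', div_lt_one hx0]
    exact hxy
  have hterm := abs_besselJ_mul_abs_besselY_le hx0 hy0 hm ((le_max_right _ _).trans hp)
  have hgeo := (hasSum_geometric_of_lt_one hr0 hr1).mul_left
    (2 * (2 * (p : ℝ) + (m : ℝ) + 2) ^ ((m : ℤ) - 1) * besselC (p + m + 1) x
        * (y / x) ^ (p + 1) / (Real.pi * x ^ m))
  have hs := Summable.of_nonneg_of_le (fun k => by positivity) hterm hgeo.summable
  refine ⟨hs, (hs.tsum_le_tsum hterm hgeo.summable).trans ?_⟩
  rw [hgeo.tsum_eq, ← div_eq_mul_inv, div_div]
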